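/- **Theorem (the Madelung transform is an isometry).** Let $M$ be a compact connected smooth manifold without boundary with a smooth Riemannian metric $\mathsf g$ and Riemannian volume $\mu$. All function spaces carry the $C^\infty$ (Fréchet) topology, quotients and subsets carry the induced topologies, and smoothness is meant in the sense of calculus in Fréchet spaces. * Let $\mathrm{Dens}(M)=\{\varrho=\rho\mu : \rho\in C^\infty(M,\mathbb R),\ \rho>0,\ \int_M\varrho=1\}$ and $T^*\mathrm{Dens}(M)=\mathrm{Dens}(M)\times C^\infty(M,\mathbb R)/\mathbb R$. A tangent vector at $(\varrho,[\theta])$ is a pair $(\dot\varrho,\dot\theta)$ with $\dot\varrho=\dot\rho\mu$, $\dot\rho,\dot\theta\in C^\infty(M,\mathbb R)$, $\int_M\dot\varrho=0$ and $\int_M\dot\theta\,\varrho=0$ (here $\dot\theta$ is the representative, normalised in this way, of a class modulo constants). The Sasaki–Fisher–Rao metric is $$\bar{\mathsf G}^*_{(\varrho,[\theta])}\big((\dot\varrho,\dot\theta),(\dot\varrho,\dot\theta)\big)=\frac14\int_M\Big(\big(\tfrac{\dot\varrho}{\varrho}\big)^2+\dot\theta^2\Big)\varrho .$$ * Let $PC^\infty(M,\mathbb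 C)$ be the set of $\psi\in C^\infty(M,\mathbb C)$ with $\int_M|\psi|^2\mu=1$ modulo $\psi\sim e^{i\alpha}\psi$, $\alpha\in\mathbb R$, and let $PC^\infty(M,\mathbb C\setminus\{0\})$ be its subset of classes of nowhere vanishing functions. With the Hermitian $L^2$ product $\langle\cdot,\cdot\rangle$, the Fubini–Study metric at $[\psi]$, on the tangent vector represented by $\dot\psi$, is $$\mathsf G^*_\psi(\dot\psi,\dot\psi)=\frac{\langle\dot\psi,\dot\psi\rangle}{\langle\psi,\psi\rangle}-\frac{\langle\psi,\dot\psi\rangle\langle\dot\psi,\psi\rangle}{\langle\psi,\psi\rangle^2}.$$ Then the Madelung transform $$\Phi: T^*\mathrm{Dens}(M)\to PC^\infty(M,\mathbb C\setminus\{0\}),\qquad \Phi(\varrho,[\theta])=\big[\sqrt{\rho e^{i\theta}}\big]=\big[\sqrt\rho\,e^{i\theta/2}\big],$$ is a Riemannian isometry onto an open subset of $PC^\infty(M,\mathbb C)$. That is: 1. $\Phi$ is a homeomorphism onto an open subset of $PC^\infty(M,\mathbb C)$, and it is smooth with smooth inverse on this subset; 2. $\mathsf G^*(T\Phi\, v,T\Phi\,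 v)=\bar{\mathsf G}^*(v,v)$ for every tangent vector $v$ of $T^*\mathrm{Dens}(M)$; 3. the image of $\Phi$ consists exactly of the classes $[\psi]$ of functions of the form $\psi=e^{f}$ with $f:M\to\mathbb C$ continuous; 4. if $M$ is simply connected, the image is all of $PC^\infty(M,\mathbb C\setminus\{0\})$, so that $\Phi$ is an isometry of $T^*\mathrm{Dens}(M)$ onto $PC^\infty(M,\mathbb C\setminus\{0\})$. -/

import Mathlib

open MeasureTheory Filter Topology
open scoped Manifold ContDiff ComplexConjugate

noncomputable section

namespace MadelungGeometry

/-! ### The Riemannian volume measure -/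

section Volume

variable {n : ℕ} {M : Type*} [TopologicalSpace M] [ChartedSpace (EuclideanSpace ℝ (Fin n)) M]
  [IsManifold (𝓡 n) ∞ M]

/-- The `i`-th coordinate vector field of the chart at `c`, at the point with coordinates `y`. -/
def coordVector (c : M) (y : EuclideanSpace ℝ (Fin n)) (i : Fin n) :
    TangentSpace (𝓡 n) ((chartAt (EuclideanSpace ℝ (Fin n)) c).symm y) :=
  mfderiv (𝓡 n) (𝓡 n) (chartAt (EuclideanSpace ℝ (Fin n)) c).symm y
    (EuclideanSpace.single i (1 : ℝ) : EuclideanSpace ℝ (Fin n))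

/-- The Gram matrix `g_ij` of the metric in the chart at `c`. -/
def chartGram
    (g : Bundle.ContMDiffRiemannianMetric (𝓡 n) ∞ (EuclideanSpace ℝ (Fin n))
      (fun x : M => TangentSpace (𝓡 n) x))
    (c : M) (y : EuclideanSpace ℝ (Fin n)) : Matrix (Fin n) (Fin n) ℝ :=
  Matrix.of fun i j =>
    g.inner ((chartAt (EuclideanSpace ℝ (Fin n)) c).symm y) (coordVector c y i) (coordVector c y j)

/-- A smooth partition of unity subordinate to the domains of the charts. -/
def chartPartition [T2Space M] [CompactSpace M] :
    SmoothPartitionOfUnity M (𝓡 n) M Set.univ :=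
  (SmoothPartitionOfUnity.exists_isSubordinate_chartAt_source (𝓡 n) M).choose

/-- The Riemannian volume measure: `∫ f dμ = ∑_c ∫ (χ_c f) ∘ φ_c⁻¹ √(det g_ij) dy`, where the `φ_c`
are the charts and `χ_c` is a subordinate partition of unity. -/
def riemannianVolume [T2Space M] [CompactSpace M] [MeasurableSpace M]
    (g : Bundle.ContMDiffRiemannianMetric (𝓡 n) ∞ (EuclideanSpace ℝ (Fin n))
      (fun x : M => TangentSpace (𝓡 n) x)) : Measure M :=
  Measure.sum fun c : M =>
    Measure.map (chartAt (EuclideanSpace ℝ (Fin n)) c).symm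
      ((volume.restrict (chartAt (EuclideanSpace ℝ (Fin n)) c).target).withDensity fun y =>
        ENNReal.ofReal
          (chartPartition (n := n) (M := M) c ((chartAt (EuclideanSpace ℝ (Fin n)) c).symm y)
            * Real.sqrt (chartGram g c y).det))

end Volume

/-! ### Differential calculus in topological vector spaces -/

section Calculus

variable {X Y : Type*} [AddCommGroup X] [Module ℝ X] [TopologicalSpace X]
  [AddCommGroup Y] [Module ℝ Y] [TopologicalSpace Y]

/-- `w` is the directional derivative of `f` at `x` in the direction `v`. -/
def HasDirDeriv (f : X → Y) (x v : X) (w : Y) : Prop :=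
  Tendsto (fun t : ℝ => t⁻¹ • (f (x + t • v) - f x)) (𝓝[≠] 0) (𝓝 w)

/-- `w` is the velocity at time `0` of the curve `γ`. -/
def HasVelocity (γ : ℝ → Y) (w : Y) : Prop :=
  Tendsto (fun t : ℝ => t⁻¹ • (γ t - γ 0)) (𝓝[≠] 0) (𝓝 w)

end Calculus

/-- `f` is of class `C^k` on the open set `U` in the sense of calculus in Fréchet spaces
(Hamilton, Michal, Bastiani): it is continuous, and for `k ≥ 1` all directional derivatives exist
and form a map `(x, v) ↦ df x v` of class `C^(k-1)`. -/
def FrechetCk : ℕ → ∀ {X : Type*} {Y : Type*} [AddCommGroup X] [Module ℝ X] [TopologicalSpace X]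
    [AddCommGroup Y] [Module ℝ Y] [TopologicalSpace Y], (X → Y) → Set X → Prop
  | 0, _, _, _, _, _, _, _, _, f, U => ContinuousOn f U
  | k + 1, X, Y, _, _, _, _, _, _, f, U =>
      ContinuousOn f U ∧ ∃ df : X × X → Y,
        (∀ x ∈ U, ∀ v, HasDirDeriv f x v (df (x, v))) ∧ FrechetCk k df (U ×ˢ Set.univ)

/-- Smoothness on an open set in the sense of calculus in Fréchet spaces. -/
def FrechetSmooth {X Y : Type*} [AddCommGroup X] [Module ℝ X] [TopologicalSpace X]
    [AddCommGroup Y] [Module ℝ Y] [TopologicalSpace Y] (f : X → Y) (U : Set X) : Prop :=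
  ∀ k : ℕ, FrechetCk k f U

/-! ### The Fréchet space of smooth functions -/

/-- The space `C^∞(M, F)`. -/
abbrev SmoothFun (n : ℕ) (M : Type*) [TopologicalSpace M]
    [ChartedSpace (EuclideanSpace ℝ (Fin n)) M] (F : Type*) [NormedAddCommGroup F]
    [NormedSpace ℝ F] :=
  C^∞⟮𝓡 n, M; 𝓘(ℝ, F), F⟯

/-- The `C^∞` topology: uniform convergence of the derivatives of every order, in every chart, on
the compact subsets of the range of the chart. -/
instance SmoothFun.instTopologicalSpace {n : ℕ} {M : Type*} [TopologicalSpace M]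
    [ChartedSpace (EuclideanSpace ℝ (Fin n)) M] {F : Type*} [NormedAddCommGroup F]
    [NormedSpace ℝ F] : TopologicalSpace (SmoothFun n M F) :=
  ⨅ (c : M) (k : ℕ), TopologicalSpace.induced
    (fun f : SmoothFun n M F =>
      UniformOnFun.ofFun
        {K : Set (EuclideanSpace ℝ (Fin n)) |
          IsCompact K ∧ K ⊆ (chartAt (EuclideanSpace ℝ (Fin n)) c).target}
        (iteratedFDeriv ℝ k (fun y => f ((chartAt (EuclideanSpace ℝ (Fin n)) c).symm y))))
    inferInstance

section Spaces

variable (n : ℕ) {M : Type*} [TopologicalSpace M] [ChartedSpace (EuclideanSpace ℝ (Fin n)) M]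
  [MeasurableSpace M] (μ : Measure M)

/-! ### The cotangent bundle of the space of densities -/

/-- `Dens(M)`: the probability densities `ϱ = ρ μ` with `ρ` smooth and positive, given by `ρ`. -/
abbrev Dens : Type _ :=
  {ρ : SmoothFun n M ℝ // (∀ x, 0 < ρ x) ∧ ∫ x, ρ x ∂μ = 1}

variable (M) in
/-- The constant functions, as a subspace of `C^∞(M, ℝ)`. -/
def constants : Submodule ℝ (SmoothFun n M ℝ) := Submodule.span ℝ {1}

/-- The (smooth part of the) cotangent bundle `T*Dens(M) = Dens(M) × C^∞(M)/ℝ`, with its Fréchet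
topology. -/
abbrev CotangentDens : Type _ := Dens n μ × (SmoothFun n M ℝ ⧸ constants n M)

variable {n μ} in
/-- The tangent vectors to `T*Dens(M)` at `(ϱ, [θ])`: pairs `(ϱ', θ')` with `ϱ' = ρ' μ` of total
mass zero, and where the class of `θ'` modulo constants is represented by its element with
`∫ θ' ϱ = 0`. -/
structure CotangentDens.Tangent (p : CotangentDens n μ) where
  rhoDot : SmoothFun n M ℝ
  thetaDot : SmoothFun n M ℝ
  integral_rhoDot : ∫ x, rhoDot x ∂μ = 0
  integral_thetaDot : ∫ x, thetaDot x * p.1.1 x ∂μ = 0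

variable {n μ} in
/-- The Sasaki–Fisher–Rao metric (as a quadratic form),
`¼ ∫ ((ϱ'/ϱ)² + θ'²) ϱ`. -/
def sasakiFisherRao {p : CotangentDens n μ} (v : p.Tangent) : ℝ :=
  1 / 4 * ∫ x, ((v.rhoDot x / p.1.1 x) ^ 2 + v.thetaDot x ^ 2) * p.1.1 x ∂μ

variable {n μ} in
/-- The curve `γ` in `T*Dens(M)` starts at `p` with velocity `v`. -/
def CotangentDens.HasVelocityAt (γ : ℝ → CotangentDens n μ) (p : CotangentDens n μ)
    (v : p.Tangent) : Prop :=
  γ 0 = p ∧ HasVelocity (fun t => (γ t).1.1) v.rhoDot ∧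
    ∃ θ : ℝ → SmoothFun n M ℝ,
      (∀ t, (constants n M).mkQ (θ t) = (γ t).2) ∧ HasVelocity θ v.thetaDot

/-! ### The projective space of smooth wave functions -/

/-- The `L²`-unit sphere in `C^∞(M, ℂ)`. -/
abbrev WaveSphere : Type _ := {ψ : SmoothFun n M ℂ // ∫ x, ‖ψ x‖ ^ 2 ∂μ = 1}

/-- Equality up to a constant phase. -/
instance phaseSetoid : Setoid (WaveSphere n μ) where
  r ψ ψ' := ∃ α : ℝ, ∀ x, ψ'.1 x = Complex.exp (Complex.I * α) * ψ.1 x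
  iseqv :=
    { refl := fun ψ => ⟨0, fun x => by simp⟩
      symm := by
        rintro ψ ψ' ⟨α, h⟩
        refine ⟨-α, fun x => ?_⟩
        rw [h x, ← mul_assoc, ← Complex.exp_add]
        simp
      trans := by
        rintro ψ ψ' ψ'' ⟨α, h⟩ ⟨β, h'⟩
        refine ⟨β + α, fun x => ?_⟩
        rw [h' x, h x, ← mul_assoc, ← Complex.exp_add]
        push_cast
        ring_nf }

/-- The complex projective space `PC^∞(M, ℂ)`, with its Fréchet (quotient) topology. -/
abbrev ProjWave : Type _ := Quotient (phaseSetoid n μ)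

/-- `PC^∞(M, ℂ∖{0})`, the classes of the nowhere vanishing functions. -/
def nonvanishing : Set (ProjWave n μ) :=
  {p | ∀ ψ : WaveSphere n μ, (⟦ψ⟧ : ProjWave n μ) = p → ∀ x, ψ.1 x ≠ 0}

variable {n} in
/-- The Hermitian `L²` inner product, conjugate linear in the first argument. -/
def hermitianL2 (φ ψ : SmoothFun n M ℂ) : ℂ := ∫ x, conj (φ x) * ψ x ∂μ

variable {n} in
/-- The Fubini–Study metric (as a quadratic form) at `[ψ]` on the tangent vector represented by
`ψ'`. -/
def fubiniStudy (ψ ψ' : SmoothFun n M ℂ) : ℂ :=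
  hermitianL2 μ ψ' ψ' / hermitianL2 μ ψ ψ
    - hermitianL2 μ ψ ψ' * hermitianL2 μ ψ' ψ / hermitianL2 μ ψ ψ ^ 2

variable {n μ} in
/-- The curve `c` in `PC^∞(M, ℂ)` starts at `[ψ]`, and its velocity there is the tangent vector
represented by `ψ'`: it lifts to a curve in the sphere that starts at `ψ` with velocity `ψ'`. -/
def ProjWave.HasVelocityAt (c : ℝ → ProjWave n μ) (ψ ψ' : SmoothFun n M ℂ) : Prop :=
  ∃ Ψ : ℝ → WaveSphere n μ, (∀ t, (⟦Ψ t⟧ : ProjWave n μ) = c t) ∧ (Ψ 0).1 = ψ ∧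
    HasVelocity (fun t => (Ψ t).1) ψ'

/-! ### Smooth maps between the two Fréchet manifolds -/

variable {n μ} in
/-- Smoothness of a map `T*Dens(M) → PC^∞(M, ℂ)`: near each point it is given by a Fréchet smooth
map defined on an open subset of `C^∞(M, ℝ) × C^∞(M, ℝ)`, with values in the sphere over
`T*Dens(M)`. -/
def SmoothToProj (f : CotangentDens n μ → ProjWave n μ) : Prop :=
  ∀ (ρ : Dens n μ) (θ : SmoothFun n M ℝ),
    ∃ (U : Set (SmoothFun n M ℝ × SmoothFun n M ℝ))
      (F : SmoothFun n M ℝ × SmoothFun n M ℝ → SmoothFun n M ℂ),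
      IsOpen U ∧ (ρ.1, θ) ∈ U ∧ FrechetSmooth F U ∧
      ∀ (ρ' : Dens n μ) (θ' : SmoothFun n M ℝ), (ρ'.1, θ') ∈ U →
        ∃ Ψ : WaveSphere n μ, Ψ.1 = F (ρ'.1, θ') ∧
          (⟦Ψ⟧ : ProjWave n μ) = f (ρ', (constants n M).mkQ θ')

variable {n μ} in
/-- Smoothness of a map `S → T*Dens(M)` on an open subset `S` of `PC^∞(M, ℂ)`: near each `[ψ] ∈ S`
it is given by a Fréchet smooth map defined on an open subset of `C^∞(M, ℂ)`. -/
def SmoothFromProj (S : Set (ProjWave n μ)) (f : S → CotangentDens n μ) : Prop :=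
  ∀ ψ : WaveSphere n μ, (⟦ψ⟧ : ProjWave n μ) ∈ S →
    ∃ (V : Set (SmoothFun n M ℂ))
      (G : SmoothFun n M ℂ → SmoothFun n M ℝ × SmoothFun n M ℝ),
      IsOpen V ∧ ψ.1 ∈ V ∧ FrechetSmooth G V ∧
      ∀ (ψ' : WaveSphere n μ) (h : (⟦ψ'⟧ : ProjWave n μ) ∈ S), ψ'.1 ∈ V →
        (f ⟨⟦ψ'⟧, h⟩).1.1 = (G ψ'.1).1 ∧
          (f ⟨⟦ψ'⟧, h⟩).2 = (constants n M).mkQ (G ψ'.1).2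

/-! ### The Madelung transform -/

variable {n μ} in
/-- `√(ρ e^{iθ}) = √ρ e^{iθ/2}`, as a smooth function of unit norm. -/
def madelungFun (ρ : Dens n μ) (θ : SmoothFun n M ℝ) : WaveSphere n μ :=
  ⟨⟨fun x => (Real.sqrt (ρ.1 x) : ℂ) * Complex.exp (Complex.I * (θ x / 2)), by
      intro x
      have h1 : ContDiffAt ℝ ∞
          (fun z : ℝ × ℝ => (Real.sqrt z.1 : ℂ) * Complex.exp (Complex.I * (z.2 / 2)))
          (ρ.1 x, θ x) := by
        have hs : ContDiffAt ℝ ∞ (fun z : ℝ × ℝ => Real.sqrt z.1) (ρ.1 x, θ x) :=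
          contDiffAt_fst.sqrt (ρ.2.1 x).ne'
        have hs' : ContDiffAt ℝ ∞ (fun z : ℝ × ℝ => (Real.sqrt z.1 : ℂ)) (ρ.1 x, θ x) :=
          (Complex.ofRealCLM.contDiff.contDiffAt).comp (ρ.1 x, θ x) hs
        have ht : ContDiffAt ℝ ∞ (fun z : ℝ × ℝ => (z.2 : ℂ)) (ρ.1 x, θ x) :=
          (Complex.ofRealCLM.contDiff.contDiffAt).comp (ρ.1 x, θ x) contDiffAt_snd
        exact hs'.mul ((contDiffAt_const.mul (ht.div_const 2)).cexp)
      have h2 : ContMDiffAt (𝓡 n) 𝓘(ℝ, ℝ × ℝ) ∞ (fun x => (ρ.1 x, θ x)) x :=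
        (ρ.1.contMDiff x).prodMk_space (θ.contMDiff x)
      exact h1.contMDiffAt.comp x h2⟩, by
    refine (integral_congr_ae (Eventually.of_forall fun x => ?_)).trans ρ.2.2
    have h : Complex.I * ((θ x : ℂ) / 2) = ((θ x / 2 : ℝ) : ℂ) * Complex.I := by
      push_cast
      ring
    show ‖(Real.sqrt (ρ.1 x) : ℂ) * Complex.exp (Complex.I * (θ x / 2))‖ ^ 2 = ρ.1 x
    rw [norm_mul, h, Complex.norm_exp_ofReal_mul_I, mul_one, Complex.norm_real, Real.norm_eq_abs,
      sq_abs, Real.sq_sqrt (ρ.2.1 x).le]⟩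

/-- The Madelung transform `Φ : T*Dens(M) → PC^∞(M, ℂ∖{0})`, `(ϱ, [θ]) ↦ [√(ρ e^{iθ})]`. -/
def madelung (p : CotangentDens n μ) : nonvanishing n μ :=
  ⟨Quotient.liftOn' p.2 (fun θ => (⟦madelungFun p.1 θ⟧ : ProjWave n μ)) (by
      intro θ θ' h
      have h' : θ - θ' ∈ constants n M :=
        (Submodule.quotientRel_def (constants n M)).1 h
      obtain ⟨a, ha⟩ := Submodule.mem_span_singleton.1 h'
      refine Quotient.sound ⟨-(a / 2), fun x => ?_⟩
      have hx : θ' x = θ x - a := by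
        have := congrArg (fun f : SmoothFun n M ℝ => f x) ha
        simp at this
        linarith
      show (Real.sqrt (p.1.1 x) : ℂ) * Complex.exp (Complex.I * (θ' x / 2))
        = Complex.exp (Complex.I * ((-(a / 2) : ℝ) : ℂ))
          * ((Real.sqrt (p.1.1 x) : ℂ) * Complex.exp (Complex.I * (θ x / 2)))
      rw [mul_left_comm, ← Complex.exp_add, hx]
      push_cast
      ring_nf), by
    obtain ⟨ρ, q⟩ := p
    induction q using Quotient.inductionOn' with
    | h θ =>
      intro ψ hψ x hx
      obtain ⟨α, hα⟩ := Quotient.exact hψ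
      have h1 : (Real.sqrt (ρ.1 x) : ℂ) * Complex.exp (Complex.I * (θ x / 2))
          = Complex.exp (Complex.I * α) * ψ.1 x := hα x
      rw [hx, mul_zero] at h1
      have h2 : (Real.sqrt (ρ.1 x) : ℂ) ≠ 0 := by
        exact_mod_cast (Real.sqrt_pos.2 (ρ.2.1 x)).ne'
      exact mul_ne_zero h2 (Complex.exp_ne_zero _) h1⟩

end Spaces

end MadelungGeometry

end

open MadelungGeometry

open MeasureTheory Filter Topology
open scoped Manifold ContDiff ComplexConjugate

noncomputable section

/-! A wave function in the image has the polar form `ψ = √ρ e^{iθ/2}` with `ρ = |ψ|²`. A global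
phase `θ` exists exactly when `ψ` has a continuous logarithm, and such a logarithm is automatically
smooth (`contMDiff_of_exp_eq`). On a connected `M` the class of `ψ` determines `θ` up to a constant,
because a continuous function with values in `2πℤ` is constant. Near a fixed `ψ` with phase `θ` the
inverse is explicit: for `ψ'` uniformly close to `ψ` the quotient `ψ'/ψ` stays in the slit plane,
and `ψ' ↦ (|ψ'|², θ + 2 arg(ψ'/ψ))` recovers density and phase
(`exists_frechetSmooth_localInverse`). This yields openness, smoothness of the inverse and the
description of the image; for simply connected `M` the logarithm comes from lifting through the
covering `exp`.

The transform and its local inverses are superposition operators `f ↦ h ∘ f` with `h` smooth on a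
finite-dimensional space. Their continuity follows from the chain rule by induction on the order
(`SmoothTendsto.comp_left`). Their differentiability follows from Hadamard's formula: the difference
quotient of `h` is `∫₀¹ Dh(a + s t b) b ds`, smooth in `(a, b, t)` up to `t = 0`, so convergence of
difference quotients is again continuity of a superposition operator. The derivative has the same
form, and `frechetCk_postcomp` iterates.

For the metrics, a lifted velocity is `ψ' = ψ (ρ'/(2ρ) + i(θ'/2 + a))`, where the real constant `a`
reflects the choice of lift. The normalisations of `ρ'` and `θ'` give `⟨ψ, ψ'⟩ = i a` and make `⟨ψ',
ψ'⟩` equal to the Sasaki–Fisher–Rao form plus `a²`; the Fubini–Study correction removes `a²`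
(`fubiniStudy_eq`). The Riemannian volume enters through its finiteness, which makes continuous
functions integrable. -/

namespace MadelungGeometry

/-! ### Convergence of all derivatives, locally uniformly on an open set -/

universe u

section SmoothConvergence

variable {Γ : Type*} {E A B : Type u} [NormedAddCommGroup E] [NormedSpace ℝ E]
  [NormedAddCommGroup A] [NormedSpace ℝ A] [NormedAddCommGroup B] [NormedSpace ℝ B]

/-- The derivatives of every order of `f γ` converge to those of `f₀` along `p`, continuously (hence
locally uniformly) on `O`. -/
def SmoothTendsto (p : Filter Γ) (f : Γ → E → A) (f₀ : E → A) (O : Set E) : Prop :=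
  ∀ k : ℕ, ∀ x ∈ O, Tendsto (fun q : Γ × E => iteratedFDeriv ℝ k (f q.1) q.2) (p ×ˢ 𝓝 x)
    (𝓝 (iteratedFDeriv ℝ k f₀ x))

theorem tendsto_iteratedFDeriv_zero_iff {p : Filter Γ} {f : Γ → E → A} {f₀ : E → A} {x : E} :
    Tendsto (fun q : Γ × E => iteratedFDeriv ℝ 0 (f q.1) q.2) (p ×ˢ 𝓝 x)
      (𝓝 (iteratedFDeriv ℝ 0 f₀ x)) ↔
    Tendsto (fun q : Γ × E => f q.1 q.2) (p ×ˢ 𝓝 x) (𝓝 (f₀ x)) := by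
  simp only [iteratedFDeriv_zero_eq_comp]
  exact ((continuousMultilinearCurryFin0 ℝ E A).symm.toHomeomorph.isInducing.tendsto_nhds_iff).symm

theorem tendsto_iteratedFDeriv_succ_iff {p : Filter Γ} {f : Γ → E → A} {f₀ : E → A} {x : E}
    {k : ℕ} :
    Tendsto (fun q : Γ × E => iteratedFDeriv ℝ (k + 1) (f q.1) q.2) (p ×ˢ 𝓝 x)
      (𝓝 (iteratedFDeriv ℝ (k + 1) f₀ x)) ↔
    Tendsto (fun q : Γ × E => iteratedFDeriv ℝ k (fderiv ℝ (f q.1)) q.2) (p ×ˢ 𝓝 x)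
      (𝓝 (iteratedFDeriv ℝ k (fderiv ℝ f₀) x)) := by
  simp only [iteratedFDeriv_succ_eq_comp_right]
  exact ((continuousMultilinearCurryRightEquiv'
    ℝ k E A).symm.toHomeomorph.isInducing.tendsto_nhds_iff).symm

theorem SmoothTendsto.tendsto {p : Filter Γ} {f : Γ → E → A} {f₀ : E → A} {O : Set E}
    (h : SmoothTendsto p f f₀ O) {x : E} (hx : x ∈ O) :
    Tendsto (fun q : Γ × E => f q.1 q.2) (p ×ˢ 𝓝 x) (𝓝 (f₀ x)) :=
  tendsto_iteratedFDeriv_zero_iff.1 (h 0 x hx)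

theorem SmoothTendsto.fderiv {p : Filter Γ} {f : Γ → E → A} {f₀ : E → A} {O : Set E}
    (h : SmoothTendsto p f f₀ O) :
    SmoothTendsto p (fun γ => fderiv ℝ (f γ)) (fderiv ℝ f₀) O :=
  fun k x hx => tendsto_iteratedFDeriv_succ_iff.1 (h (k + 1) x hx)

omit [NormedSpace ℝ E] in
theorem eventually_snd_mem {p : Filter Γ} {O : Set E} (hO : IsOpen O) {x : E} (hx : x ∈ O) :
    ∀ᶠ q : Γ × E in p ×ˢ 𝓝 x, q.2 ∈ O :=
  tendsto_snd.eventually (hO.mem_nhds hx)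

theorem SmoothTendsto.prodMk {p : Filter Γ} {f : Γ → E → A} {f₀ : E → A} {g : Γ → E → B}
    {g₀ : E → B} {O : Set E} (hO : IsOpen O)
    (hf' : ∀ γ, ContDiffOn ℝ ∞ (f γ) O) (hf₀ : ContDiffOn ℝ ∞ f₀ O)
    (hg' : ∀ γ, ContDiffOn ℝ ∞ (g γ) O) (hg₀ : ContDiffOn ℝ ∞ g₀ O)
    (hf : SmoothTendsto p f f₀ O) (hg : SmoothTendsto p g g₀ O) :
    SmoothTendsto p (fun γ y => (f γ y, g γ y)) (fun y => (f₀ y, g₀ y)) O := by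
  intro k x hx
  have hk : (k : WithTop ℕ∞) ≤ (∞ : WithTop ℕ∞) := by exact_mod_cast le_top
  rw [iteratedFDeriv_prodMk (hf₀.contDiffAt (hO.mem_nhds hx)) (hg₀.contDiffAt (hO.mem_nhds hx)) hk]
  have h := ((ContinuousMultilinearMap.prodL ℝ (fun _ : Fin k => E) A B).continuous.tendsto
    (iteratedFDeriv ℝ k f₀ x, iteratedFDeriv ℝ k g₀ x)).comp ((hf k x hx).prodMk_nhds (hg k x hx))
  refine h.congr' ?_
  filter_upwards [eventually_snd_mem hO hx] with q hq
  exact (iteratedFDeriv_prodMk ((hf' q.1).contDiffAt (hO.mem_nhds hq))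
    ((hg' q.1).contDiffAt (hO.mem_nhds hq)) hk).symm

/-- Postcomposition with a smooth map preserves convergence of all derivatives. -/
theorem SmoothTendsto.comp_left {p : Filter Γ} {f : Γ → E → A} {f₀ : E → A}
    {O : Set E} (hO : IsOpen O) {h : A → B} (hh : ContDiff ℝ ∞ h)
    (hf' : ∀ γ, ContDiffOn ℝ ∞ (f γ) O) (hf₀ : ContDiffOn ℝ ∞ f₀ O)
    (hf : SmoothTendsto p f f₀ O) :
    SmoothTendsto p (fun γ => h ∘ f γ) (h ∘ f₀) O := by
  intro k
  -- The chain rule writes `D(h ∘ u)` as `h₁ ∘ (u, Du)` with `h₁(a, L) = Dh(a) ∘ L`, so order `k +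
  -- 1` for `h` reduces to order `k` for `h₁`. The spaces change, hence the generalisation and the
  -- common universe.
  induction k generalizing A B with
  | zero =>
    intro x hx
    exact (tendsto_iteratedFDeriv_zero_iff (f := fun γ => h ∘ f γ)).2
      ((hh.continuous.tendsto _).comp (hf.tendsto hx))
  | succ k ih =>
    intro x hx
    refine (tendsto_iteratedFDeriv_succ_iff (f := fun γ => h ∘ f γ)).2 ?_
    have hh1 : ContDiff ℝ ∞ (fun z : A × (E →L[ℝ] A) => (_root_.fderiv ℝ h z.1).comp z.2) :=
      ((hh.fderiv_right (by simp)).comp contDiff_fst).clm_comp contDiff_snd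
    have hfd : ∀ {u : E → A}, ContDiffOn ℝ ∞ u O → ContDiffOn ℝ ∞ (_root_.fderiv ℝ u) O :=
      fun hu => hu.fderiv_of_isOpen hO (by simp)
    have key : ∀ {u : E → A}, ContDiffOn ℝ ∞ u O → ∀ y ∈ O,
        iteratedFDeriv ℝ k (_root_.fderiv ℝ (h ∘ u)) y =
        iteratedFDeriv ℝ k ((fun z : A × (E →L[ℝ] A) => (_root_.fderiv ℝ h z.1).comp z.2) ∘
          fun y => (u y, _root_.fderiv ℝ u y)) y := by
      intro u hu y hy
      refine Filter.EventuallyEq.eq_of_nhds (Filter.EventuallyEq.iteratedFDeriv ℝ ?_ k)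
      filter_upwards [hO.mem_nhds hy] with w hw
      exact fderiv_comp w (hh.differentiable (by simp) _)
        ((hu.contDiffAt (hO.mem_nhds hw)).differentiableAt (by simp))
    rw [key hf₀ x hx]
    refine (ih hh1 (fun γ => (hf' γ).prodMk (hfd (hf' γ))) (hf₀.prodMk (hfd hf₀))
      (hf.prodMk hO hf' hf₀ (fun γ => hfd (hf' γ)) (hfd hf₀) hf.fderiv) x hx).congr' ?_
    filter_upwards [eventually_snd_mem hO hx] with q hq
    exact (key (hf' q.1) q.2 hq).symm

end SmoothConvergence

/-! ### Smooth dependence of integrals on parameters -/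

section ParametricIntegral

variable {P B : Type u} [NormedAddCommGroup P] [NormedSpace ℝ P] [FiniteDimensional ℝ P]
  [NormedAddCommGroup B] [NormedSpace ℝ B]

/-- Closed balls of `P` are compact, so the partial derivative is bounded on a ball times the
interval and a constant serves as dominating function. -/
theorem hasFDerivAt_intervalIntegral_of_contDiff {G : P × ℝ → B} (hG : ContDiff ℝ 1 G) (a b : ℝ)
    (x : P) :
    HasFDerivAt (fun x => ∫ s in a..b, G (x, s))
      (∫ s in a..b, (fderiv ℝ G (x, s)).comp (ContinuousLinearMap.inl ℝ P ℝ)) x := by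
  have hG' : Continuous fun z : P × ℝ => (fderiv ℝ G z).comp (ContinuousLinearMap.inl ℝ P ℝ) :=
    (hG.continuous_fderiv (by simp)).clm_comp continuous_const
  obtain ⟨C, hC⟩ := (((ProperSpace.isCompact_closedBall x 1).prod
    (isCompact_uIcc (a := a) (b := b))).image hG'.norm).bddAbove
  refine (intervalIntegral.hasFDerivAt_integral_of_dominated_of_fderiv_le (bound := fun _ => C)
    (F' := fun x s => (fderiv ℝ G (x, s)).comp (ContinuousLinearMap.inl ℝ P ℝ))
    (Metric.ball_mem_nhds x one_pos) ?_ ?_ ?_ ?_ ?_ ?_)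
  · refine Eventually.of_forall fun y => ?_
    exact (hG.continuous.comp (by fun_prop : Continuous fun s : ℝ => (y, s))).aestronglyMeasurable
  · exact (hG.continuous.comp (by fun_prop : Continuous fun s : ℝ => (x, s))).intervalIntegrable _ _
  · exact (hG'.comp (by fun_prop : Continuous fun s : ℝ => (x, s))).aestronglyMeasurable
  · refine Eventually.of_forall fun s hs y hy => hC ⟨(y, s), ⟨Metric.ball_subset_closedBall hy,
      Set.uIoc_subset_uIcc hs⟩, rfl⟩
  · exact intervalIntegrable_const
  · refine Eventually.of_forall fun s _ y _ => ?_
    exact (hG.differentiable (by simp) (y, s)).hasFDerivAt.comp y (hasFDerivAt_prodMk_left y s)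

/-- The derivative is an integral of the same kind with values in `P →L[ℝ] B`, so induction on the
order works once `B` varies. -/
theorem contDiff_intervalIntegral [CompleteSpace B] {G : P × ℝ → B} (hG : ContDiff ℝ ∞ G) (a b : ℝ) :
    ContDiff ℝ ∞ (fun x => ∫ s in a..b, G (x, s)) := by
  rw [contDiff_infty]
  intro k
  induction k generalizing B with
  | zero =>
    refine contDiff_zero.2 (continuous_iff_continuousAt.2 fun x => ?_)
    exact (hasFDerivAt_intervalIntegral_of_contDiff (hG.of_le (by simp)) a b x).continuousAt
  | succ k ih =>
    have h := hasFDerivAt_intervalIntegral_of_contDiff (hG.of_le (by simp)) a b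
    push_cast
    rw [contDiff_succ_iff_fderiv]
    refine ⟨fun x => (h x).differentiableAt, by simp, ?_⟩
    rw [funext fun x => (h x).fderiv]
    exact ih ((hG.fderiv_right (by simp)).clm_comp contDiff_const)

end ParametricIntegral

/-! ### Superposition operators between spaces of smooth functions -/

theorem tendstoUniformlyOnFilter_nhds_iff_tendsto {Γ X Y : Type*} [TopologicalSpace X]
    [UniformSpace Y] {p : Filter Γ} {F : Γ → X → Y} {f : X → Y} {x : X} (hf : ContinuousAt f x) :
    TendstoUniformlyOnFilter F f p (𝓝 x) ↔
      Tendsto (fun q : Γ × X => F q.1 q.2) (p ×ˢ 𝓝 x) (𝓝 (f x)) := by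
  have hf' : Tendsto (fun q : Γ × X => f q.2) (p ×ˢ 𝓝 x) (𝓝 (f x)) := hf.tendsto.comp tendsto_snd
  rw [tendstoUniformlyOnFilter_iff_tendsto]
  refine ⟨fun h => (Uniform.tendsto_congr h).1 hf', fun h => ?_⟩
  exact (hf'.prodMk_nhds h).mono_right (nhds_le_uniformity _)

namespace SmoothFun

section Topology

variable {n : ℕ} {M : Type*} [TopologicalSpace M] [ChartedSpace (EuclideanSpace ℝ (Fin n)) M]
  {A B : Type} [NormedAddCommGroup A] [NormedSpace ℝ A] [NormedAddCommGroup B] [NormedSpace ℝ B]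
  {Γ : Type*} {p : Filter Γ}

/-- The representative of a smooth function in the chart at `c`. -/
def inChart (c : M) (f : SmoothFun n M A) (y : EuclideanSpace ℝ (Fin n)) : A :=
  f ((chartAt (EuclideanSpace ℝ (Fin n)) c).symm y)

/-- The superposition operator `f ↦ h ∘ f` of a smooth map `h`. -/
def postcomp (h : A → B) (hh : ContDiff ℝ ∞ h) (f : SmoothFun n M A) : SmoothFun n M B :=
  ⟨fun x => h (f x), hh.contMDiff.comp f.contMDiff⟩

/-- The smooth function `x ↦ (f x, g x)`. -/
def pair (f : SmoothFun n M A) (g : SmoothFun n M B) : SmoothFun n M (A × B) :=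
  ⟨fun x => (f x, g x), f.contMDiff.prodMk_space g.contMDiff⟩

/-- A constant function. -/
def const (a : A) : SmoothFun n M A := ⟨fun _ => a, contMDiff_const⟩

variable [IsManifold (𝓡 n) ∞ M]

theorem contDiffOn_inChart (c : M) (f : SmoothFun n M A) :
    ContDiffOn ℝ ∞ (inChart c f) (chartAt (EuclideanSpace ℝ (Fin n)) c).target := by
  rw [← contMDiffOn_iff_contDiffOn]
  exact f.contMDiff.comp_contMDiffOn (contMDiffOn_chart_symm (I := 𝓡 n) (x := c))

/-- On an open set of a Euclidean space, uniform convergence on compacts is locally uniform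
convergence; for a continuous limit this is joint convergence in parameter and point. Continuity can
then be proved without seminorms. -/
theorem tendsto_iff {F : Γ → SmoothFun n M A} {f : SmoothFun n M A} :
    Tendsto F p (𝓝 f) ↔ ∀ c : M, SmoothTendsto p (fun γ => inChart c (F γ)) (inChart c f)
      (chartAt (EuclideanSpace ℝ (Fin n)) c).target := by
  have hO (c : M) : IsOpen (chartAt (EuclideanSpace ℝ (Fin n)) c).target :=
    (chartAt (EuclideanSpace ℝ (Fin n)) c).open_target
  simp only [nhds_iInf, tendsto_iInf, nhds_induced, tendsto_comap_iff]
  refine forall_congr' fun c => forall_congr' fun k => ?_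
  rw [UniformOnFun.tendsto_iff_tendstoUniformlyOn]
  trans TendstoLocallyUniformlyOn (fun γ => iteratedFDeriv ℝ k (inChart c (F γ)))
    (iteratedFDeriv ℝ k (inChart c f)) p (chartAt (EuclideanSpace ℝ (Fin n)) c).target
  · rw [tendstoLocallyUniformlyOn_iff_forall_isCompact (hO c)]
    exact ⟨fun h K h1 h2 => h K ⟨h2, h1⟩, fun h K hK => h K hK.2 hK.1⟩
  · rw [tendstoLocallyUniformlyOn_iff_filter]
    refine forall₂_congr fun x hx => ?_
    rw [(hO c).nhdsWithin_eq hx]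
    refine tendstoUniformlyOnFilter_nhds_iff_tendsto ?_
    have h1 := ((contDiffOn_inChart c f).contDiffAt ((hO c).mem_nhds hx)).iteratedFDeriv_right
      (i := k) (m := 0) (by rw [zero_add]; exact_mod_cast le_top)
    exact h1.continuousAt

theorem continuous_postcomp (h : A → B) (hh : ContDiff ℝ ∞ h) :
    Continuous (postcomp h hh : SmoothFun n M A → SmoothFun n M B) := by
  refine continuous_iff_continuousAt.2 fun f => tendsto_iff.2 fun c => ?_
  exact (tendsto_iff.1 tendsto_id c).comp_left (chartAt _ c).open_target hh
    (fun g => contDiffOn_inChart c g) (contDiffOn_inChart c f)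

theorem continuous_pair :
    Continuous (fun q : SmoothFun n M A × SmoothFun n M B => pair q.1 q.2) := by
  refine continuous_iff_continuousAt.2 fun q => tendsto_iff.2 fun c => ?_
  exact SmoothTendsto.prodMk (chartAt _ c).open_target (fun g => contDiffOn_inChart c g.1)
    (contDiffOn_inChart c q.1) (fun g => contDiffOn_inChart c g.2) (contDiffOn_inChart c q.2)
    (tendsto_iff.1 continuous_fst.continuousAt c) (tendsto_iff.1 continuous_snd.continuousAt c)

theorem continuous_const : Continuous (const : A → SmoothFun n M A) := by
  refine continuous_iff_continuousAt.2 fun a => tendsto_iff.2 fun c k x _ => ?_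
  cases k with
  | zero => exact (tendsto_iteratedFDeriv_zero_iff
      (f := fun b : A => inChart c (const b : SmoothFun n M A))).2 tendsto_fst
  | succ k =>
    have h (b : A) : iteratedFDeriv ℝ (k + 1) (inChart c (const b : SmoothFun n M A)) = 0 :=
      iteratedFDeriv_succ_const k b
    simp only [h]
    exact tendsto_const_nhds

instance : ContinuousAdd (SmoothFun n M A) where
  continuous_add :=
    (continuous_postcomp (fun z : A × A => z.1 + z.2) (by fun_prop)).comp continuous_pair

instance : ContinuousSMul ℝ (SmoothFun n M A) where
  continuous_smul :=
    ((continuous_postcomp (fun z : ℝ × A => z.1 • z.2) (by fun_prop)).comp continuous_pair).comp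
      (continuous_const.prodMap continuous_id)

theorem tendsto_eval {F : Γ → SmoothFun n M A} {f : SmoothFun n M A} (h : Tendsto F p (𝓝 f))
    (x : M) : Tendsto (fun q : Γ × M => F q.1 q.2) (p ×ˢ 𝓝 x) (𝓝 (f x)) := by
  set φ := chartAt (EuclideanSpace ℝ (Fin n)) x
  have hx : x ∈ φ.source := mem_chart_source _ x
  have h1 := (tendsto_iff.1 h x).tendsto (φ.map_source hx)
  have h2 : Tendsto (fun q : Γ × M => (q.1, φ q.2)) (p ×ˢ 𝓝 x) (p ×ˢ 𝓝 (φ x)) :=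
    tendsto_id.prodMap (φ.continuousAt hx)
  have h3 := h1.comp h2
  simp only [inChart] at h3
  rw [φ.left_inv hx] at h3
  refine h3.congr' ?_
  filter_upwards [tendsto_snd.eventually (φ.open_source.mem_nhds hx)] with q hq
  simp only [Function.comp_apply]
  rw [φ.left_inv hq]

theorem continuous_eval (x : M) : Continuous (fun f : SmoothFun n M A => f x) := by
  refine continuous_iff_continuousAt.2 fun f => ?_
  exact (tendsto_eval (tendsto_id (x := 𝓝 f)) x).comp
    (tendsto_id.prodMk (tendsto_const_nhds (x := x)))

/-- Compactness of `M` makes the pointwise open condition uniform. Such sets are the domains of the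
local formulas for the transform and its inverse. -/
theorem isOpen_setOf_forall_mem [CompactSpace M] {W : Set A} (hW : IsOpen W) :
    IsOpen {f : SmoothFun n M A | ∀ x, f x ∈ W} := by
  refine isOpen_iff_mem_nhds.2 fun f hf => ?_
  have h : ∀ᶠ g : SmoothFun n M A in 𝓝 f, ∀ x ∈ (Set.univ : Set M), g x ∈ W :=
    isCompact_univ.eventually_forall_of_forall_eventually fun x _ => by
      rw [nhds_prod_eq]
      exact (tendsto_eval (tendsto_id (x := 𝓝 f)) x).eventually (hW.mem_nhds (hf x))
  filter_upwards [h] with g hg x using hg x trivial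

/-- `pair` of two continuous linear maps, as a continuous linear map. -/
def pairCLM {X : Type*} [AddCommGroup X] [Module ℝ X] [TopologicalSpace X]
    (L₁ : X →L[ℝ] SmoothFun n M A) (L₂ : X →L[ℝ] SmoothFun n M B) :
    X →L[ℝ] SmoothFun n M (A × B) where
  toFun x := pair (L₁ x) (L₂ x)
  map_add' x y := by
    rw [map_add, map_add]
    rfl
  map_smul' t x := by
    rw [map_smul, map_smul]
    rfl
  cont := continuous_pair.comp (L₁.continuous.prodMk L₂.continuous)

/-- The mean of `s ↦ Dh(a + s t b) b` over `[0, 1]`, as a function of `(a, b, t)`. -/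
def meanFDeriv (h : A → B) (q : A × A × ℝ) : B :=
  ∫ s in (0 : ℝ)..1, fderiv ℝ h (q.1 + (s * q.2.2) • q.2.1) q.2.1

omit [IsManifold (𝓡 n) ∞ M] in
theorem contDiff_fderiv_apply {h : A → B} (hh : ContDiff ℝ ∞ h) :
    ContDiff ℝ ∞ (fun q : A × A => fderiv ℝ h q.1 q.2) :=
  ((hh.fderiv_right (by simp)).comp contDiff_fst).clm_apply contDiff_snd

theorem contDiff_meanFDeriv [FiniteDimensional ℝ A] [CompleteSpace B] {h : A → B}
    (hh : ContDiff ℝ ∞ h) : ContDiff ℝ ∞ (meanFDeriv h) :=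
  contDiff_intervalIntegral
    (G := fun z : (A × A × ℝ) × ℝ => fderiv ℝ h (z.1.1 + (z.2 * z.1.2.2) • z.1.2.1) z.1.2.1)
    ((contDiff_fderiv_apply hh).comp
      (f := fun z : (A × A × ℝ) × ℝ => (z.1.1 + (z.2 * z.1.2.2) • z.1.2.1, z.1.2.1))
      (by fun_prop)) 0 1

theorem meanFDeriv_zero [CompleteSpace B] (h : A → B) (a b : A) :
    meanFDeriv h (a, b, 0) = fderiv ℝ h a b := by
  simp [meanFDeriv]

/-- The fundamental theorem of calculus along `s ↦ h (a + (s * t) • b)`. With `contDiff_meanFDeriv`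
it shows that the difference quotient extends smoothly across `t = 0`. -/
theorem meanFDeriv_of_ne [CompleteSpace B] {h : A → B} (hh : ContDiff ℝ ∞ h) (a b : A) {t : ℝ}
    (ht : t ≠ 0) : meanFDeriv h (a, b, t) = t⁻¹ • (h (a + t • b) - h a) := by
  have hd (s : ℝ) : HasDerivAt (fun s : ℝ => h (a + (s * t) • b))
      (t • fderiv ℝ h (a + (s * t) • b) b) s := by
    have h1 : HasDerivAt (fun s : ℝ => a + (s * t) • b) (t • b) s := by
      simpa using (((hasDerivAt_id s).mul_const t).smul_const b).const_add a
    have h2 := (hh.differentiable (by simp) (a + (s * t) • b)).hasFDerivAt.comp_hasDerivAt s h1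
    rwa [map_smul] at h2
  have hc : Continuous fun s : ℝ => fderiv ℝ h (a + (s * t) • b) b :=
    (contDiff_fderiv_apply hh).continuous.comp
      (by fun_prop : Continuous fun s : ℝ => (a + (s * t) • b, b))
  have h3 := intervalIntegral.integral_eq_sub_of_hasDerivAt (a := 0) (b := 1) (fun s _ => hd s)
    ((hc.const_smul t).intervalIntegrable _ _)
  rw [intervalIntegral.integral_smul] at h3
  simp only [one_mul, zero_mul, zero_smul, add_zero] at h3
  rw [← h3, inv_smul_smul₀ ht]
  rfl

/-- For `t ≠ 0` the difference quotient is the superposition of `meanFDeriv h` with `(f, v, t)`, the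
number `t` being read as a constant function. Continuity of this expression at `t = 0` replaces any
estimate. -/
theorem hasDirDeriv_postcomp [FiniteDimensional ℝ A] [CompleteSpace B] {h : A → B}
    (hh : ContDiff ℝ ∞ h) (f v : SmoothFun n M A) :
    HasDirDeriv (postcomp h hh) f v
      (postcomp (fun q : A × A => fderiv ℝ h q.1 q.2) (contDiff_fderiv_apply hh) (pair f v)) := by
  let K (t : ℝ) : SmoothFun n M B :=
    postcomp (meanFDeriv h) (contDiff_meanFDeriv hh) (pair f (pair v (const t)))
  have hK : Continuous K := by
    refine (continuous_postcomp _ _).comp (continuous_pair.comp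
      (Continuous.prodMk _root_.continuous_const
        (continuous_pair.comp (Continuous.prodMk _root_.continuous_const continuous_const))))
  have h0 : K 0 = postcomp (fun q : A × A => fderiv ℝ h q.1 q.2) (contDiff_fderiv_apply hh)
      (pair f v) := ContMDiffMap.ext fun x => meanFDeriv_zero h (f x) (v x)
  have h1 : Tendsto K (𝓝[≠] 0) (𝓝 (K 0)) := hK.continuousAt.tendsto.mono_left nhdsWithin_le_nhds
  rw [h0] at h1
  refine h1.congr' ?_
  filter_upwards [self_mem_nhdsWithin] with t ht
  exact ContMDiffMap.ext fun x => meanFDeriv_of_ne hh (f x) (v x) ht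

/-- The derivative is the superposition of `(a, b) ↦ Dh(a) b` with the affine map `(x, v) ↦ (L x, L₀
v)`, so this class of maps is closed under differentiation. Affine `L` is allowed because the local
inverse pairs its argument with fixed functions. -/
theorem frechetCk_postcomp (k : ℕ) {X : Type*} [AddCommGroup X] [Module ℝ X] [TopologicalSpace X]
    [FiniteDimensional ℝ A] [CompleteSpace B] {h : A → B} (hh : ContDiff ℝ ∞ h)
    {L : X → SmoothFun n M A} (L₀ : X →L[ℝ] SmoothFun n M A) (hL : Continuous L)
    (hL₀ : ∀ x v (t : ℝ), L (x + t • v) = L x + t • L₀ v) (U : Set X) :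
    FrechetCk k (fun x => postcomp h hh (L x)) U := by
  induction k generalizing X A with
  | zero => exact ((continuous_postcomp h hh).comp hL).continuousOn
  | succ k ih =>
    refine ⟨((continuous_postcomp h hh).comp hL).continuousOn, fun z =>
      postcomp (fun q : A × A => fderiv ℝ h q.1 q.2) (contDiff_fderiv_apply hh)
        (pair (L z.1) (L₀ z.2)), fun x _ v => ?_, ?_⟩
    · have h1 := hasDirDeriv_postcomp hh (L x) (L₀ v)
      unfold HasDirDeriv at h1 ⊢
      simpa only [hL₀] using h1
    · refine ih (contDiff_fderiv_apply hh) (pairCLM (L₀.comp (ContinuousLinearMap.fst ℝ X X))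
        (L₀.comp (ContinuousLinearMap.snd ℝ X X)))
        (continuous_pair.comp ((hL.comp continuous_fst).prodMk (L₀.continuous.comp continuous_snd)))
        (fun z w t => ?_) _
      have h1 : pair (L (z.1 + t • w.1)) (L₀ (z.2 + t • w.2)) =
          pair (L z.1) (L₀ z.2) + t • pair (L₀ w.1) (L₀ w.2) := by
        rw [hL₀, map_add, map_smul]
        rfl
      exact h1

end Topology

end SmoothFun

/-- A pair of `C^k` maps is `C^k`. -/
theorem FrechetCk.prodMk {k : ℕ} {X Y Z : Type*} [AddCommGroup X] [Module ℝ X]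
    [TopologicalSpace X] [AddCommGroup Y] [Module ℝ Y] [TopologicalSpace Y] [AddCommGroup Z]
    [Module ℝ Z] [TopologicalSpace Z] {f : X → Y} {g : X → Z} {U : Set X} (hf : FrechetCk k f U)
    (hg : FrechetCk k g U) : FrechetCk k (fun x => (f x, g x)) U := by
  induction k generalizing X with
  | zero => exact ContinuousOn.prodMk hf hg
  | succ k ih =>
    obtain ⟨hfc, df, hdf, hf'⟩ := hf
    obtain ⟨hgc, dg, hdg, hg'⟩ := hg
    exact ⟨hfc.prodMk hgc, fun z => (df z, dg z),
      fun x hx v => (hdf x hx v).prodMk_nhds (hdg x hx v), ih hf' hg'⟩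

/-! ### Finiteness of the Riemannian volume -/

section Volume

variable {n : ℕ} {M : Type*} [TopologicalSpace M] [ChartedSpace (EuclideanSpace ℝ (Fin n)) M]
  [IsManifold (𝓡 n) ∞ M]

/-- The field is the tangent map of the inverse chart applied to a constant field on Euclidean
space. -/
theorem contMDiffOn_coordVector (c : M) (i : Fin n) :
    ContMDiffOn (𝓡 n) ((𝓡 n).prod 𝓘(ℝ, EuclideanSpace ℝ (Fin n))) ∞
      (fun y => Bundle.TotalSpace.mk' (EuclideanSpace ℝ (Fin n))
        (E := fun x : M => TangentSpace (𝓡 n) x)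
        ((chartAt (EuclideanSpace ℝ (Fin n)) c).symm y) (coordVector c y i))
      (chartAt (EuclideanSpace ℝ (Fin n)) c).target := by
  have hO := (chartAt (EuclideanSpace ℝ (Fin n)) c).open_target
  have h1 := (contMDiffOn_chart_symm (I := 𝓡 n) (n := ∞) (x := c)).contMDiffOn_tangentMapWithin
    (m := ∞) (by simp) hO.uniqueMDiffOn
  have h2 : ContMDiff (𝓡 n) (𝓡 n).tangent ∞
      (fun y : EuclideanSpace ℝ (Fin n) =>
        (⟨y, (EuclideanSpace.single i (1 : ℝ) : EuclideanSpace ℝ (Fin n))⟩ :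
          TangentBundle (𝓡 n) (EuclideanSpace ℝ (Fin n)))) :=
    contMDiff_vectorSpace_iff_contDiff.2 contDiff_const
  refine (h1.comp h2.contMDiffOn (fun y hy => hy)).congr fun y hy => ?_
  simp only [Function.comp_apply, tangentMapWithin, coordVector, mfderivWithin_of_isOpen hO hy]

theorem continuousOn_chartGram
    (g : Bundle.ContMDiffRiemannianMetric (𝓡 n) ∞ (EuclideanSpace ℝ (Fin n))
      (fun x : M => TangentSpace (𝓡 n) x)) (c : M) :
    ContinuousOn (chartGram g c) (chartAt (EuclideanSpace ℝ (Fin n)) c).target := by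
  refine continuousOn_pi.2 fun i => continuousOn_pi.2 fun j => ?_
  intro y hy
  have h1 := g.contMDiff.contMDiffAt.comp_contMDiffWithinAt y
    (contMDiffOn_chart_symm (I := 𝓡 n) (n := ∞) (x := c) y hy)
  have h2 : ContMDiffWithinAt (𝓡 n) ((𝓡 n).prod 𝓘(ℝ)) ∞
      (fun y => Bundle.TotalSpace.mk' ℝ (E := Bundle.Trivial M ℝ)
        ((chartAt (EuclideanSpace ℝ (Fin n)) c).symm y) (chartGram g c y i j))
      (chartAt (EuclideanSpace ℝ (Fin n)) c).target y := by
    apply ContMDiffWithinAt.clm_bundle_apply₂ (F₁ := EuclideanSpace ℝ (Fin n))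
      (F₂ := EuclideanSpace ℝ (Fin n))
    · exact h1
    · exact contMDiffOn_coordVector c i y hy
    · exact contMDiffOn_coordVector c j y hy
  rw [Bundle.contMDiffWithinAt_totalSpace] at h2
  exact h2.2.continuousWithinAt

variable [T2Space M] [CompactSpace M] [MeasurableSpace M]

omit [MeasurableSpace M] in
-- The density vanishes off the chart image of the support of the partition function; this image is
-- compact and the density is continuous near it, hence bounded.
theorem lintegral_chart_lt_top
    (g : Bundle.ContMDiffRiemannianMetric (𝓡 n) ∞ (EuclideanSpace ℝ (Fin n))
      (fun x : M => TangentSpace (𝓡 n) x)) (c : M) :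
    ∫⁻ y in (chartAt (EuclideanSpace ℝ (Fin n)) c).target, ENNReal.ofReal
      (chartPartition (n := n) (M := M) c ((chartAt (EuclideanSpace ℝ (Fin n)) c).symm y)
        * Real.sqrt (chartGram g c y).det) < ⊤ := by
  set φ := chartAt (EuclideanSpace ℝ (Fin n)) c
  set w : EuclideanSpace ℝ (Fin n) → ℝ := fun y =>
    chartPartition (n := n) (M := M) c (φ.symm y) * Real.sqrt (chartGram g c y).det
  have hsub : tsupport (chartPartition (n := n) (M := M) c) ⊆ φ.source :=
    (SmoothPartitionOfUnity.exists_isSubordinate_chartAt_source (𝓡 n) M).choose_spec c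
  set K := φ '' tsupport (chartPartition (n := n) (M := M) c)
  have hK : IsCompact K :=
    (isClosed_tsupport _).isCompact.image_of_continuousOn (φ.continuousOn.mono hsub)
  have hKt : K ⊆ φ.target := by
    rintro _ ⟨x, hx, rfl⟩
    exact φ.map_source (hsub hx)
  have hw : ContinuousOn w φ.target := by
    refine ContinuousOn.mul ?_ ?_
    · exact (chartPartition (n := n) (M := M) c).contMDiff.continuous.comp_continuousOn
        φ.continuousOn_symm
    · exact Real.continuous_sqrt.comp_continuousOn
        ((continuous_id.matrix_det).comp_continuousOn (continuousOn_chartGram g c))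
  obtain ⟨C, hC⟩ := hK.bddAbove_image (hw.mono hKt)
  calc ∫⁻ y in φ.target, ENNReal.ofReal (w y)
      ≤ ∫⁻ y in φ.target, K.indicator (fun _ => ENNReal.ofReal C) y := by
        refine setLIntegral_mono' φ.open_target.measurableSet fun y hy => ?_
        by_cases hyK : y ∈ K
        · rw [Set.indicator_of_mem hyK]
          exact ENNReal.ofReal_le_ofReal (hC ⟨y, hyK, rfl⟩)
        · have h0 : chartPartition (n := n) (M := M) c (φ.symm y) = 0 :=
            image_eq_zero_of_notMem_tsupport fun h => hyK ⟨_, h, φ.right_inv hy⟩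
          simp [w, h0]
    _ ≤ ∫⁻ y, K.indicator (fun _ => ENNReal.ofReal C) y := setLIntegral_le_lintegral _ _
    _ = ENNReal.ofReal C * volume K := lintegral_indicator_const hK.measurableSet _
    _ < ⊤ := ENNReal.mul_lt_top ENNReal.ofReal_lt_top hK.measure_lt_top

theorem isFiniteMeasure_riemannianVolume
    (g : Bundle.ContMDiffRiemannianMetric (𝓡 n) ∞ (EuclideanSpace ℝ (Fin n))
      (fun x : M => TangentSpace (𝓡 n) x)) : IsFiniteMeasure (riemannianVolume g) := by
  -- `Measure.map` along a map that is not a.e. measurable is zero, so the inequality holds without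
  -- checking measurability of the inverse charts.
  have hmap {X : Type _} [MeasurableSpace X] (ν : Measure X) (f : X → M) :
      Measure.map f ν Set.univ ≤ ν Set.univ := by
    by_cases hf : AEMeasurable f ν
    · rw [Measure.map_apply_of_aemeasurable hf MeasurableSet.univ, Set.preimage_univ]
    · simp [Measure.map_of_not_aemeasurable hf]
  have hfin : {c : M | (Function.support (chartPartition (n := n) (M := M) c)).Nonempty}.Finite :=
    (chartPartition (n := n) (M := M)).locallyFinite.finite_nonempty_of_compact
  refine ⟨?_⟩
  rw [riemannianVolume, Measure.sum_apply _ MeasurableSet.univ,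
    tsum_eq_sum (s := hfin.toFinset) fun c hc => ?_]
  · refine ENNReal.sum_lt_top.2 fun c _ => (hmap _ _).trans_lt ?_
    rw [withDensity_apply _ MeasurableSet.univ, Measure.restrict_univ]
    exact lintegral_chart_lt_top g c
  · have h0 (x : M) : chartPartition (n := n) (M := M) c x = 0 := by
      by_contra h
      exact hc (hfin.mem_toFinset.2 ⟨x, h⟩)
    simp [h0]

end Volume

/-! ### The Madelung transform and its local inverses as superposition operators -/

/-- Multiplication by a cutoff function. Square root and logarithm are smooth only on open sets,
while superposition operators are built from globally smooth maps; the values of one function on the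
compact `M` form the set `K`. -/
theorem exists_contDiff_eqOn_of_isCompact {A B : Type*} [NormedAddCommGroup A] [NormedSpace ℝ A]
    [FiniteDimensional ℝ A] [NormedAddCommGroup B] [NormedSpace ℝ B] {K W : Set A}
    (hK : IsCompact K) (hW : IsOpen W) (hKW : K ⊆ W) {h : A → B} (hh : ContDiffOn ℝ ∞ h W) :
    ∃ (h' : A → B) (O : Set A), ContDiff ℝ ∞ h' ∧ IsOpen O ∧ K ⊆ O ∧ O ⊆ W ∧ Set.EqOn h' h O := by
  obtain ⟨t, ht, hKt, htW⟩ := exists_compact_between hK hW hKW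
  obtain ⟨f, hf1, hf0, -⟩ := exists_contMDiffMap_one_nhds_of_subset_interior 𝓘(ℝ, A) (n := ⊤)
    hK.isClosed hKt
  obtain ⟨O, hO, hKO, hO1⟩ := eventually_nhdsSet_iff_exists.1 hf1
  refine ⟨fun x => f x • h x, O ∩ W, ?_, hO.inter hW, Set.subset_inter hKO hKW,
    Set.inter_subset_right, fun x hx => by simp [hO1 x hx.1]⟩
  refine contDiff_iff_contDiffAt.2 fun x => ?_
  by_cases hx : x ∈ W
  · exact (f.contMDiff.contDiff.contDiffAt).smul (hh.contDiffAt (hW.mem_nhds hx))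
  · have h0 : (fun x => f x • h x) =ᶠ[𝓝 x] fun _ => (0 : B) := by
      filter_upwards [ht.isClosed.isOpen_compl.mem_nhds fun hxt => hx (htW hxt)] with y hy
      simp [hf0 y hy]
    exact contDiffAt_const.congr_of_eventuallyEq h0

theorem contDiffOn_sqrt_mul_exp :
    ContDiffOn ℝ ∞ (fun z : ℝ × ℝ => (Real.sqrt z.1 : ℂ) * Complex.exp (Complex.I * (z.2 / 2)))
      {z | 0 < z.1} := by
  intro z hz
  have hs : ContDiffAt ℝ ∞ (fun z : ℝ × ℝ => (Real.sqrt z.1 : ℂ)) z :=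
    (Complex.ofRealCLM.contDiff.contDiffAt).comp z (contDiffAt_fst.sqrt (ne_of_gt hz))
  have ht : ContDiffAt ℝ ∞ (fun z : ℝ × ℝ => (z.2 : ℂ)) z :=
    (Complex.ofRealCLM.contDiff.contDiffAt).comp z contDiffAt_snd
  exact (hs.mul ((contDiffAt_const.mul (ht.div_const 2)).cexp)).contDiffWithinAt

theorem isOpen_mul_mem_slitPlane :
    IsOpen {z : ℂ × ℂ × ℝ | z.1 * z.2.1 ∈ Complex.slitPlane} :=
  Complex.isOpen_slitPlane.preimage (by fun_prop)

/-- At `(ψ' x, (ψ x)⁻¹, θ x)` this expression is the phase of `ψ'` continued from the phase `θ` of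
`ψ`. The factor 2 matches the exponent `iθ/2`. -/
theorem contDiffOn_phase :
    ContDiffOn ℝ ∞ (fun z : ℂ × ℂ × ℝ => 2 * (Complex.log (z.1 * z.2.1)).im + z.2.2)
      {z | z.1 * z.2.1 ∈ Complex.slitPlane} := by
  intro z hz
  have h1 : ContDiffAt ℝ ∞ (fun z : ℂ × ℂ × ℝ => z.1 * z.2.1) z := by fun_prop
  have h2 : ContDiffAt ℝ ∞ Complex.log (z.1 * z.2.1) := (Complex.contDiffAt_log hz).restrict_scalars ℝ
  have h3 : ContDiffAt ℝ ∞ (fun z : ℂ × ℂ × ℝ => (Complex.log (z.1 * z.2.1)).im) z :=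
    Complex.imCLM.contDiff.contDiffAt.comp z (ContDiffAt.comp z (g := Complex.log) h2 h1)
  exact ((contDiffAt_const.mul h3).add (by fun_prop)).contDiffWithinAt

theorem norm_mul_exp_phase {z z' w : ℂ} {t : ℝ} (hw : w * z = 1)
    (hz : z = (‖z‖ : ℂ) * Complex.exp (Complex.I * (t / 2))) :
    (‖z'‖ : ℂ) * Complex.exp (Complex.I * (((2 * (Complex.log (z' * w)).im + t : ℝ) : ℂ) / 2))
      = z' := by
  have hn : ‖w‖ * ‖z‖ = 1 := by rw [← norm_mul, hw, norm_one]
  have hn' : ‖z'‖ = ‖z' * w‖ * ‖z‖ := by rw [norm_mul, mul_assoc, hn, mul_one]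
  have h1 : Complex.I * (((2 * (Complex.log (z' * w)).im + t : ℝ) : ℂ) / 2) =
      Complex.arg (z' * w) * Complex.I + Complex.I * (t / 2) := by
    rw [Complex.log_im]
    push_cast
    ring
  calc (‖z'‖ : ℂ) * Complex.exp (Complex.I * (((2 * (Complex.log (z' * w)).im + t : ℝ) : ℂ) / 2))
      = ((‖z' * w‖ : ℂ) * Complex.exp (Complex.arg (z' * w) * Complex.I)) *
        ((‖z‖ : ℂ) * Complex.exp (Complex.I * (t / 2))) := by
        rw [h1, Complex.exp_add, hn']
        push_cast
        ring
    _ = z' * (w * z) := by rw [Complex.norm_mul_exp_arg_mul_I, ← hz, mul_assoc]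
    _ = z' := by rw [hw, mul_one]

section Transform

variable {n : ℕ} {M : Type*} [TopologicalSpace M] [CompactSpace M]
  [ChartedSpace (EuclideanSpace ℝ (Fin n)) M] [IsManifold (𝓡 n) ∞ M]
  [MeasurableSpace M] {μ : Measure M}

theorem exists_frechetSmooth_madelungFun (ρ : Dens n μ) (θ : SmoothFun n M ℝ) :
    ∃ (U : Set (SmoothFun n M ℝ × SmoothFun n M ℝ))
      (F : SmoothFun n M ℝ × SmoothFun n M ℝ → SmoothFun n M ℂ),
      IsOpen U ∧ (ρ.1, θ) ∈ U ∧ FrechetSmooth F U ∧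
      ∀ (ρ' : Dens n μ) (θ' : SmoothFun n M ℝ), (ρ'.1, θ') ∈ U →
        (madelungFun ρ' θ').1 = F (ρ'.1, θ') := by
  obtain ⟨h, O, hh, hO, hKO, -, hhO⟩ := exists_contDiff_eqOn_of_isCompact
    (isCompact_range (SmoothFun.pair ρ.1 θ).contMDiff.continuous)
    (isOpen_lt continuous_const continuous_fst) (by rintro _ ⟨x, rfl⟩; exact ρ.2.1 x)
    contDiffOn_sqrt_mul_exp
  refine ⟨{q | ∀ x, SmoothFun.pair q.1 q.2 x ∈ O}, fun q =>
    SmoothFun.postcomp h hh (SmoothFun.pair q.1 q.2),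
    (SmoothFun.isOpen_setOf_forall_mem hO).preimage SmoothFun.continuous_pair,
    fun x => hKO ⟨x, rfl⟩, fun k => ?_, fun ρ' θ' hq => ContMDiffMap.ext fun x => ?_⟩
  · exact SmoothFun.frechetCk_postcomp k hh (SmoothFun.pairCLM (ContinuousLinearMap.fst ℝ _ _)
      (ContinuousLinearMap.snd ℝ _ _)) SmoothFun.continuous_pair (fun _ _ _ => rfl) _
  · exact (hhO (hq x)).symm

theorem continuous_madelungFun :
    Continuous (fun q : Dens n μ × SmoothFun n M ℝ => madelungFun q.1 q.2) := by
  refine Topology.IsInducing.subtypeVal.continuous_iff.2 (continuous_iff_continuousAt.2 fun q => ?_)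
  obtain ⟨U, F, hU, hq, hF, hFU⟩ := exists_frechetSmooth_madelungFun q.1 q.2
  have hι : Continuous fun q : Dens n μ × SmoothFun n M ℝ => (q.1.1, q.2) := by fun_prop
  have h1 : ContinuousAt F (q.1.1, q.2) :=
    ContinuousOn.continuousAt (hF 0) (hU.mem_nhds hq)
  refine (ContinuousAt.comp (f := fun q : Dens n μ × SmoothFun n M ℝ => (q.1.1, q.2)) h1
    hι.continuousAt).congr ?_
  filter_upwards [(hU.preimage hι).mem_nhds hq] with q' hq'
  exact (hFU q'.1 q'.2 hq').symm

/-- A smooth function all of whose values are nonzero has a smooth inverse. -/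
def SmoothFun.inv (ψ : SmoothFun n M ℂ) (hψ : ∀ x, ψ x ≠ 0) : SmoothFun n M ℂ :=
  ⟨fun x => (ψ x)⁻¹, fun x =>
    ((contDiffAt_inv ℝ (hψ x)).contMDiffAt).comp x (ψ.contMDiff x)⟩

/-- The quotient `ψ'/ψ` equals 1 at `ψ' = ψ`, so it stays in the slit plane nearby, where the
principal logarithm gives the change of phase. The density is `|ψ'|²`. -/
theorem exists_frechetSmooth_localInverse (ψ : WaveSphere n μ) (θ : SmoothFun n M ℝ)
    (h0 : ∀ x, ψ.1 x ≠ 0)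
    (hψ : ∀ x, ψ.1 x = (‖ψ.1 x‖ : ℂ) * Complex.exp (Complex.I * (θ x / 2))) :
    ∃ (V : Set (SmoothFun n M ℂ)) (G : SmoothFun n M ℂ → SmoothFun n M ℝ × SmoothFun n M ℝ),
      IsOpen V ∧ ψ.1 ∈ V ∧ FrechetSmooth G V ∧
      ∀ ψ' : WaveSphere n μ, ψ'.1 ∈ V →
        ∃ ρ' : Dens n μ, ρ'.1 = (G ψ'.1).1 ∧ madelungFun ρ' (G ψ'.1).2 = ψ' := by
  set w := SmoothFun.inv ψ.1 h0
  have hw (x : M) : w x * ψ.1 x = 1 := inv_mul_cancel₀ (h0 x)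
  let L (φ : SmoothFun n M ℂ) : SmoothFun n M (ℂ × ℂ × ℝ) :=
    SmoothFun.pair φ (SmoothFun.pair w θ)
  have hL : Continuous L :=
    SmoothFun.continuous_pair.comp (continuous_id.prodMk continuous_const)
  obtain ⟨h, O, hh, hO, hKO, hOW, hhO⟩ := exists_contDiff_eqOn_of_isCompact
    (isCompact_range (L ψ.1).contMDiff.continuous) isOpen_mul_mem_slitPlane (by
      rintro _ ⟨x, rfl⟩
      show ψ.1 x * w x ∈ Complex.slitPlane
      rw [mul_comm, hw]
      exact Complex.one_mem_slitPlane) contDiffOn_phase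
  refine ⟨{φ | ∀ x, L φ x ∈ O}, fun φ =>
    (SmoothFun.postcomp (fun z : ℂ => ‖z‖ ^ 2) (contDiff_norm_sq ℝ) φ,
      SmoothFun.postcomp h hh (L φ)),
    (SmoothFun.isOpen_setOf_forall_mem hO).preimage hL, fun x => hKO ⟨x, rfl⟩,
    fun k => FrechetCk.prodMk ?_ ?_, fun ψ' hψ' => ?_⟩
  · exact SmoothFun.frechetCk_postcomp k (contDiff_norm_sq ℝ) (ContinuousLinearMap.id ℝ _)
      continuous_id (fun _ _ _ => rfl) _
  · refine SmoothFun.frechetCk_postcomp k hh (SmoothFun.pairCLM (ContinuousLinearMap.id ℝ _) 0) hL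
      (fun φ v t => ContMDiffMap.ext fun x => ?_) _
    show (φ x + t • v x, w x, θ x) = (φ x, w x, θ x) + t • (v x, (0 : ℂ × ℝ))
    simp
  · have hne (x : M) : ψ'.1 x ≠ 0 :=
      left_ne_zero_of_mul (Complex.slitPlane_ne_zero (hOW (hψ' x)))
    refine ⟨⟨SmoothFun.postcomp (fun z : ℂ => ‖z‖ ^ 2) (contDiff_norm_sq ℝ) ψ'.1,
      fun x => pow_pos (norm_pos_iff.2 (hne x)) 2, ψ'.2⟩, rfl,
      Subtype.ext (ContMDiffMap.ext fun x => ?_)⟩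
    show (Real.sqrt (‖ψ'.1 x‖ ^ 2) : ℂ) * Complex.exp (Complex.I * ((h (L ψ'.1 x) : ℂ) / 2)) = _
    rw [Real.sqrt_sq (norm_nonneg _), hhO (hψ' x)]
    exact norm_mul_exp_phase (hw x) (hψ x)

omit [CompactSpace M] [MeasurableSpace M] [IsManifold (𝓡 n) ∞ M] in
/-- A continuous logarithm of a smooth function is smooth. -/
theorem contMDiff_of_exp_eq {ψ : SmoothFun n M ℂ} {f : M → ℂ} (hf : Continuous f)
    (h : ∀ x, ψ x = Complex.exp (f x)) : ContMDiff (𝓡 n) 𝓘(ℝ, ℂ) ∞ f := by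
  intro x
  have h1 : ContMDiffAt (𝓡 n) 𝓘(ℝ, ℂ) ∞
      (fun y => f x + Complex.log (ψ y * Complex.exp (-f x))) x := by
    have h2 : ContDiffAt ℝ ∞ (fun z : ℂ => f x + Complex.log (z * Complex.exp (-f x))) (ψ x) := by
      refine contDiffAt_const.add (ContDiffAt.comp (ψ x) (g := Complex.log)
        (ContDiffAt.restrict_scalars ℝ (Complex.contDiffAt_log ?_)) (by fun_prop))
      rw [h, ← Complex.exp_add, add_neg_cancel, Complex.exp_zero]
      exact Complex.one_mem_slitPlane
    exact h2.contMDiffAt.comp x (ψ.contMDiff x)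
  refine h1.congr_of_eventuallyEq ?_
  -- Near `x` the imaginary part of `f y - f x` lies in `(-π, π)`, where the principal logarithm
  -- inverts `exp`.
  have h3 : Tendsto (fun y => (f y - f x).im) (𝓝 x) (𝓝 0) := by
    have h4 : Continuous fun y => (f y - f x).im := by fun_prop
    simpa using h4.tendsto x
  filter_upwards [h3.eventually (Ioo_mem_nhds (neg_lt_zero.2 Real.pi_pos) Real.pi_pos)] with y hy
  rw [h y, ← Complex.exp_add, ← sub_eq_add_neg, Complex.log_exp hy.1 hy.2.le]
  ring

end Transform

/-! ### Injectivity, image and openness of the Madelung transform -/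

section Embedding

variable {n : ℕ} {M : Type*} [TopologicalSpace M]
  [ChartedSpace (EuclideanSpace ℝ (Fin n)) M] [MeasurableSpace M] {μ : Measure M}

theorem madelungFun_apply (ρ : Dens n μ) (θ : SmoothFun n M ℝ) (x : M) :
    (madelungFun ρ θ).1 x = (Real.sqrt (ρ.1 x) : ℂ) * Complex.exp (Complex.I * (θ x / 2)) := rfl

theorem norm_exp_I_mul (a : ℝ) : ‖Complex.exp (Complex.I * a)‖ = 1 := by
  rw [mul_comm, Complex.norm_exp_ofReal_mul_I]

theorem norm_madelungFun (ρ : Dens n μ) (θ : SmoothFun n M ℝ) (x : M) :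
    ‖(madelungFun ρ θ).1 x‖ = Real.sqrt (ρ.1 x) := by
  have h := norm_exp_I_mul (θ x / 2)
  push_cast at h
  rw [madelungFun_apply, norm_mul, h, mul_one, Complex.norm_real, Real.norm_eq_abs,
    abs_of_nonneg (Real.sqrt_nonneg _)]

theorem madelungFun_ne_zero (ρ : Dens n μ) (θ : SmoothFun n M ℝ) (x : M) :
    (madelungFun ρ θ).1 x ≠ 0 := by
  rw [← norm_pos_iff, norm_madelungFun]
  exact Real.sqrt_pos.2 (ρ.2.1 x)

theorem sqrt_density_injective {ρ ρ' : Dens n μ} (h : ∀ x, Real.sqrt (ρ.1 x) = Real.sqrt (ρ'.1 x)) :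
    ρ = ρ' :=
  Subtype.ext (ContMDiffMap.ext fun x =>
    (Real.sqrt_inj (ρ.2.1 x).le (ρ'.2.1 x).le).1 (h x))

/-- A continuous function on a connected space with values in `2πℤ` is constant. -/
theorem eq_of_forall_exp_I_mul_eq_one {X : Type*} [TopologicalSpace X] [PreconnectedSpace X]
    {u : X → ℝ} (hu : Continuous u) (h : ∀ x, Complex.exp (Complex.I * u x) = 1) (x y : X) :
    u x = u y := by
  have h' (x : X) : ∃ k : ℤ, u x = k * (2 * Real.pi) := by
    obtain ⟨k, hk⟩ := Complex.exp_eq_one_iff.1 (h x)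
    refine ⟨k, ?_⟩
    have h1 := congrArg Complex.im hk
    simpa using h1
  choose k hk using h'
  have hk' : (fun x => (k x : ℝ)) = fun x => u x / (2 * Real.pi) := by
    funext x
    rw [hk x, mul_div_cancel_right₀ _ Real.two_pi_pos.ne']
  have hc : Continuous k := by
    refine Int.isClosedEmbedding_coe_real.isInducing.continuous_iff.2 ?_
    show Continuous fun x => (k x : ℝ)
    rw [hk']
    exact hu.div_const _
  rw [hk x, hk y, PreconnectedSpace.constant ‹_› hc (x := x) (y := y)]

theorem madelung_mk (ρ : Dens n μ) (θ : SmoothFun n M ℝ) :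
    (madelung n μ (ρ, (constants n M).mkQ θ) : ProjWave n μ) = ⟦madelungFun ρ θ⟧ := rfl

/-- Moduli determine the density. The phases then satisfy `α + θ/2 - θ'/2 ∈ 2πℤ` at each point, and
connectedness makes this function constant. -/
theorem madelung_injective [ConnectedSpace M] : Function.Injective (madelung n μ) := by
  rintro ⟨ρ, q⟩ ⟨ρ', q'⟩ h
  obtain ⟨θ, rfl⟩ := (constants n M).mkQ_surjective q
  obtain ⟨θ', rfl⟩ := (constants n M).mkQ_surjective q'
  have h' : (⟦madelungFun ρ θ⟧ : ProjWave n μ) = ⟦madelungFun ρ' θ'⟧ := congrArg Subtype.val h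
  obtain ⟨α, hα⟩ := Quotient.exact h'
  have hρ : ρ = ρ' := sqrt_density_injective fun x => by
    rw [← norm_madelungFun ρ θ, ← norm_madelungFun ρ' θ', hα x, norm_mul, norm_exp_I_mul, one_mul]
  subst hρ
  have hθ (x : M) : Complex.exp (Complex.I * ((α + θ x / 2 - θ' x / 2 : ℝ) : ℂ)) = 1 := by
    have h1 := hα x
    rw [madelungFun_apply, madelungFun_apply, mul_left_comm, ← Complex.exp_add] at h1
    have h2 := mul_left_cancel₀
      (Complex.ofReal_ne_zero.2 (Real.sqrt_pos.2 (ρ.2.1 x)).ne') h1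
    have h3 : Complex.I * ((α + θ x / 2 - θ' x / 2 : ℝ) : ℂ) =
        (Complex.I * α + Complex.I * (θ x / 2)) - Complex.I * (θ' x / 2) := by
      push_cast
      ring
    rw [h3, Complex.exp_sub, ← h2, div_self (Complex.exp_ne_zero _)]
  have hc : Continuous fun x => α + θ x / 2 - θ' x / 2 :=
    (continuous_const.add (θ.contMDiff.continuous.div_const 2)).sub
      (θ'.contMDiff.continuous.div_const 2)
  obtain ⟨x₀⟩ := (inferInstance : Nonempty M)
  refine Prod.ext rfl ((Submodule.Quotient.eq _).2
    (Submodule.mem_span_singleton.2 ⟨θ x₀ - θ' x₀, ContMDiffMap.ext fun x => ?_⟩))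
  have h4 := eq_of_forall_exp_I_mul_eq_one hc hθ x x₀
  have h5 : θ x₀ - θ' x₀ = θ x - θ' x := by linarith
  show (θ x₀ - θ' x₀) * 1 = θ x - θ' x
  rw [mul_one, h5]

variable [CompactSpace M] [IsManifold (𝓡 n) ∞ M]

omit [MeasurableSpace M] [CompactSpace M] [IsManifold (𝓡 n) ∞ M] in
/-- A wave function with a continuous logarithm has a smooth phase. -/
theorem exists_phase_of_exp_eq {ψ : SmoothFun n M ℂ} {f : M → ℂ} (hf : Continuous f)
    (h : ∀ x, ψ x = Complex.exp (f x)) :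
    ∃ θ : SmoothFun n M ℝ,
      ∀ x, ψ x = (‖ψ x‖ : ℂ) * Complex.exp (Complex.I * (θ x / 2)) := by
  refine ⟨⟨fun x => 2 * (f x).im, ?_⟩, fun x => ?_⟩
  · exact (contDiff_const.mul Complex.imCLM.contDiff).contMDiff.comp (contMDiff_of_exp_eq hf h)
  · show ψ x = (‖ψ x‖ : ℂ) * Complex.exp (Complex.I * (((2 * (f x).im : ℝ) : ℂ) / 2))
    rw [h x, Complex.norm_exp, Complex.ofReal_exp, ← Complex.exp_add]
    congr 1
    push_cast
    rw [mul_div_cancel_left₀ _ (two_ne_zero), mul_comm, Complex.re_add_im]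

theorem mk_mem_range_madelung_iff (ψ : WaveSphere n μ) :
    (⟦ψ⟧ : ProjWave n μ) ∈ Set.range (fun p => (madelung n μ p : ProjWave n μ)) ↔
      ∃ f : M → ℂ, Continuous f ∧ ∀ x, ψ.1 x = Complex.exp (f x) := by
  constructor
  · rintro ⟨⟨ρ, q⟩, h⟩
    obtain ⟨θ, rfl⟩ := (constants n M).mkQ_surjective q
    obtain ⟨α, hα⟩ := Quotient.exact h
    refine ⟨fun x => Complex.I * α +
      ((Real.log (Real.sqrt (ρ.1 x)) : ℂ) + Complex.I * (θ x / 2)), ?_, fun x => ?_⟩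
    · have h1 : Continuous fun x => Real.log (Real.sqrt (ρ.1 x)) :=
        (Real.continuous_sqrt.comp ρ.1.contMDiff.continuous).log
          fun x => (Real.sqrt_pos.2 (ρ.2.1 x)).ne'
      have h2 : Continuous fun x => (θ x : ℂ) :=
        Complex.continuous_ofReal.comp θ.contMDiff.continuous
      exact continuous_const.add ((Complex.continuous_ofReal.comp h1).add
        (continuous_const.mul (h2.div_const 2)))
    · rw [Complex.exp_add, Complex.exp_add, ← Complex.ofReal_exp,
        Real.exp_log (Real.sqrt_pos.2 (ρ.2.1 x))]
      exact hα x
  · rintro ⟨f, hf, h⟩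
    obtain ⟨θ, hθ⟩ := exists_phase_of_exp_eq hf h
    -- The local inverse around `ψ`, evaluated at `ψ` itself, already provides a preimage.
    obtain ⟨V, G, -, hψV, -, hG⟩ := exists_frechetSmooth_localInverse ψ θ
      (fun x => by rw [h]; exact Complex.exp_ne_zero _) hθ
    obtain ⟨ρ', -, hρ'⟩ := hG ψ hψV
    exact ⟨(ρ', (constants n M).mkQ (G ψ.1).2), (madelung_mk _ _).trans (by rw [hρ'])⟩

theorem exists_frechetSmooth_localInverse_of_mem_range {ψ : WaveSphere n μ}
    (h : (⟦ψ⟧ : ProjWave n μ) ∈ Set.range (fun p => (madelung n μ p : ProjWave n μ))) :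
    ∃ (V : Set (SmoothFun n M ℂ)) (G : SmoothFun n M ℂ → SmoothFun n M ℝ × SmoothFun n M ℝ),
      IsOpen V ∧ ψ.1 ∈ V ∧ FrechetSmooth G V ∧
      ∀ ψ' : WaveSphere n μ, ψ'.1 ∈ V →
        ∃ ρ' : Dens n μ, ρ'.1 = (G ψ'.1).1 ∧ madelungFun ρ' (G ψ'.1).2 = ψ' := by
  obtain ⟨f, hf, hψ⟩ := (mk_mem_range_madelung_iff ψ).1 h
  obtain ⟨θ, hθ⟩ := exists_phase_of_exp_eq hf hψ
  exact exists_frechetSmooth_localInverse ψ θ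
    (fun x => by rw [hψ]; exact Complex.exp_ne_zero _) hθ

theorem continuous_madelung :
    Continuous (fun p => (madelung n μ p : ProjWave n μ)) := by
  -- A product of quotient maps need not be a quotient map; openness of the projection modulo
  -- constants makes it one here.
  have hq : IsOpenQuotientMap
      (Prod.map id (constants n M).mkQ : Dens n μ × SmoothFun n M ℝ → CotangentDens n μ) :=
    IsOpenQuotientMap.id.prodMap ⟨(constants n M).mkQ_surjective, continuous_quot_mk,
      (constants n M).isOpenMap_mkQ⟩
  rw [hq.isQuotientMap.continuous_iff]
  exact continuous_quotient_mk'.comp continuous_madelungFun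

/-- Around a point `ψ` over the image of `S`, the local inverse is a continuous map `D` with `Φ ∘ D`
the class map, and injectivity gives `D ψ = p ∈ S`. Hence `D ⁻¹' S` is a neighbourhood of `ψ` lying
over the image of `S`. -/
theorem isOpenMap_madelung [ConnectedSpace M] :
    IsOpenMap (fun p => (madelung n μ p : ProjWave n μ)) := by
  intro S hS
  rw [← isQuotientMap_quotient_mk'.isOpen_preimage, isOpen_iff_mem_nhds]
  rintro ψ ⟨p, hpS, hpψ⟩
  obtain ⟨V, G, hV, hψV, hG, hGV⟩ := exists_frechetSmooth_localInverse_of_mem_range ⟨p, hpψ⟩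
  have hV' : IsOpen {ψ' : WaveSphere n μ | ψ'.1 ∈ V} := hV.preimage continuous_subtype_val
  choose r hr hrG using fun ψ' : {ψ' : WaveSphere n μ | ψ'.1 ∈ V} => hGV ψ'.1 ψ'.2
  have hGc : Continuous fun ψ' : {ψ' : WaveSphere n μ | ψ'.1 ∈ V} => G ψ'.1.1 :=
    ContinuousOn.comp_continuous (hG 0) (continuous_subtype_val.comp continuous_subtype_val)
      fun ψ' => ψ'.2
  have hrc : Continuous r := by
    refine Topology.IsInducing.subtypeVal.continuous_iff.2 ?_
    exact (continuous_fst.comp hGc).congr fun ψ' => (hr ψ').symm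
  let D (ψ' : {ψ' : WaveSphere n μ | ψ'.1 ∈ V}) : CotangentDens n μ :=
    (r ψ', (constants n M).mkQ (G ψ'.1.1).2)
  have hD : Continuous D :=
    hrc.prodMk (continuous_quot_mk.comp (continuous_snd.comp hGc))
  have hDΦ (ψ' : {ψ' : WaveSphere n μ | ψ'.1 ∈ V}) :
      (madelung n μ (D ψ') : ProjWave n μ) = ⟦ψ'.1⟧ := by
    rw [madelung_mk, hrG]
  have hDp : D ⟨ψ, hψV⟩ = p :=
    madelung_injective (Subtype.ext ((hDΦ ⟨ψ, hψV⟩).trans hpψ.symm))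
  have hopen : IsOpen (Subtype.val '' (D ⁻¹' S)) :=
    hV'.isOpenEmbedding_subtypeVal.isOpenMap _ (hS.preimage hD)
  refine mem_of_superset (hopen.mem_nhds ⟨⟨ψ, hψV⟩, by rwa [Set.mem_preimage, hDp], rfl⟩) ?_
  rintro _ ⟨ψ', hψ', rfl⟩
  exact ⟨D ψ', hψ', hDΦ ψ'⟩

theorem isOpenEmbedding_madelung [ConnectedSpace M] :
    IsOpenEmbedding (fun p => (madelung n μ p : ProjWave n μ)) :=
  .of_continuous_injective_isOpenMap continuous_madelung
    (Subtype.val_injective.comp madelung_injective) isOpenMap_madelung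

theorem smoothToProj_madelung : SmoothToProj (fun p => (madelung n μ p : ProjWave n μ)) := by
  intro ρ θ
  obtain ⟨U, F, hU, hq, hF, hFU⟩ := exists_frechetSmooth_madelungFun ρ θ
  exact ⟨U, F, hU, hq, hF, fun ρ' θ' h => ⟨madelungFun ρ' θ', hFU ρ' θ' h, rfl⟩⟩

/-- The inverse may be taken by choice: injectivity forces it to agree with each smooth local
inverse. -/
theorem exists_smoothFromProj_madelung [ConnectedSpace M] :
    ∃ Ψ : Set.range (fun p => (madelung n μ p : ProjWave n μ)) → CotangentDens n μ,
      (∀ p, Ψ ⟨madelung n μ p, p, rfl⟩ = p) ∧ SmoothFromProj _ Ψ := by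
  choose Ψ hΨ using fun s : Set.range (fun p => (madelung n μ p : ProjWave n μ)) => s.2
  have hΨ' (p : CotangentDens n μ) : Ψ ⟨madelung n μ p, p, rfl⟩ = p :=
    madelung_injective (Subtype.ext (hΨ ⟨madelung n μ p, p, rfl⟩))
  refine ⟨Ψ, hΨ', fun ψ hψ => ?_⟩
  obtain ⟨V, G, hV, hψV, hG, hGV⟩ := exists_frechetSmooth_localInverse_of_mem_range hψ
  refine ⟨V, G, hV, hψV, hG, fun ψ' h hψ' => ?_⟩
  obtain ⟨ρ', hρ', hρG⟩ := hGV ψ' hψ'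
  have h1 : Ψ ⟨⟦ψ'⟧, h⟩ = (ρ', (constants n M).mkQ (G ψ'.1).2) :=
    madelung_injective (Subtype.ext ((hΨ ⟨⟦ψ'⟧, h⟩).trans (by rw [madelung_mk, hρG])))
  rw [h1]
  exact ⟨hρ', rfl⟩

/-- A nowhere vanishing function on a simply connected, locally path connected space lifts through
the covering `exp : ℂ → ℂ∖{0}`, which gives the continuous logarithm. -/
theorem madelung_surjective [SimplyConnectedSpace M] : Function.Surjective (madelung n μ) := by
  rintro ⟨q, hq⟩
  obtain ⟨ψ, rfl⟩ := Quotient.exists_rep q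
  have := ChartedSpace.locallyPathConnectedSpace (EuclideanSpace ℝ (Fin n)) M
  obtain ⟨x₀⟩ := (inferInstance : Nonempty M)
  have h0 : ∀ x, ψ.1 x ≠ 0 := hq ψ rfl
  obtain ⟨f, ⟨-, hf⟩, -⟩ := Complex.isCoveringMapOn_exp.existsUnique_continuousMap_lifts
    ⟨ψ.1, ψ.1.contMDiff.continuous⟩ (Complex.exp_log (h0 x₀)) h0
  obtain ⟨p, hp⟩ := (mk_mem_range_madelung_iff ψ).2
    ⟨f, f.continuous, fun x => (congrFun hf x).symm⟩
  exact ⟨p, Subtype.ext hp⟩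

end Embedding

/-! ### The metrics -/

section Metric

variable {n : ℕ} {M : Type*} [TopologicalSpace M] [CompactSpace M]
  [ChartedSpace (EuclideanSpace ℝ (Fin n)) M] [IsManifold (𝓡 n) ∞ M]
  [MeasurableSpace M] [BorelSpace M] {μ : Measure M}

omit [CompactSpace M] [MeasurableSpace M] [BorelSpace M] in
theorem HasVelocity.hasDerivAt_eval {F : Type} [NormedAddCommGroup F] [NormedSpace ℝ F]
    {γ : ℝ → SmoothFun n M F} {w : SmoothFun n M F} (h : HasVelocity γ w) (x : M) :
    HasDerivAt (fun t => γ t x) (w x) 0 := by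
  rw [hasDerivAt_iff_tendsto_slope_zero]
  have h1 := ((SmoothFun.continuous_eval (A := F) x).tendsto w).comp h
  refine h1.congr fun t => ?_
  rw [zero_add]
  rfl

omit [IsManifold (𝓡 n) ∞ M] in
theorem SmoothFun.integrable [IsFiniteMeasure μ] {F : Type} [NormedAddCommGroup F]
    [NormedSpace ℝ F] [SecondCountableTopology F] (f : SmoothFun n M F) :
    Integrable (fun x => f x) μ :=
  f.contMDiff.continuous.integrable_of_hasCompactSupport
    (HasCompactSupport.of_compactSpace _)

theorem integrable_of_continuous [IsFiniteMeasure μ] {f : M → ℝ} (hf : Continuous f) :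
    Integrable f μ :=
  hf.integrable_of_hasCompactSupport (HasCompactSupport.of_compactSpace _)

/-- Existence of curves: each tangent vector is the velocity of a curve whose image under the
Madelung transform has a velocity. -/
theorem exists_curve_hasVelocityAt [IsFiniteMeasure μ] (p : CotangentDens n μ) (v : p.Tangent) :
    ∃ γ : ℝ → CotangentDens n μ, CotangentDens.HasVelocityAt γ p v ∧
      ∃ ψ ψ' : SmoothFun n M ℂ,
        ProjWave.HasVelocityAt (fun t => (madelung n μ (γ t) : ProjWave n μ)) ψ ψ' := by
  obtain ⟨ρ, q⟩ := p
  obtain ⟨θ, rfl⟩ := (constants n M).mkQ_surjective q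
  have hint (t : ℝ) : ∫ x, (ρ.1 + t • v.rhoDot) x ∂μ = 1 := by
    have h1 : ∫ x, (ρ.1 x + t * v.rhoDot x) ∂μ = 1 := by
      rw [integral_add ρ.1.integrable (v.rhoDot.integrable.const_mul t), integral_const_mul,
        v.integral_rhoDot, ρ.2.2, mul_zero, add_zero]
    exact h1
  classical
  -- The line `ρ + t ρ'` is known to be positive only for small `t`. The default value `ρ` elsewhere
  -- does not affect the velocity at 0.
  let r (t : ℝ) : Dens n μ :=
    if h : ∀ x, 0 < (ρ.1 + t • v.rhoDot) x then ⟨ρ.1 + t • v.rhoDot, h, hint t⟩ else ρ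
  have hline : Continuous fun t : ℝ => ρ.1 + t • v.rhoDot := by fun_prop
  have hline' : Continuous fun t : ℝ => θ + t • v.thetaDot := by fun_prop
  have hr0 : r 0 = ρ := by
    simp only [r]
    split_ifs
    · exact Subtype.ext (by simp)
    · rfl
  have hr : ∀ᶠ t in 𝓝 (0 : ℝ), (r t).1 = ρ.1 + t • v.rhoDot := by
    have h1 : IsOpen {t : ℝ | ∀ x, (ρ.1 + t • v.rhoDot) x ∈ Set.Ioi (0 : ℝ)} :=
      (SmoothFun.isOpen_setOf_forall_mem isOpen_Ioi).preimage hline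
    filter_upwards [h1.mem_nhds (fun x => by simpa using ρ.2.1 x)] with t ht
    simp only [r]
    rw [dif_pos (show ∀ x, 0 < (ρ.1 + t • v.rhoDot) x from ht)]
  have hvel {X : Type _} [AddCommGroup X] [Module ℝ X] [TopologicalSpace X] (a b : X) :
      HasVelocity (fun t : ℝ => a + t • b) b := by
    refine tendsto_const_nhds.congr' ?_
    filter_upwards [self_mem_nhdsWithin] with t ht
    rw [zero_smul, add_zero, add_sub_cancel_left, inv_smul_smul₀ ht]
  obtain ⟨U, F, hU, hq, hF, hFU⟩ := exists_frechetSmooth_madelungFun ρ θ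
  -- The velocity of the image curve is the directional derivative of the local formula `F`.
  obtain ⟨-, dF, hdF, -⟩ := hF 1
  refine ⟨fun t => (r t, (constants n M).mkQ (θ + t • v.thetaDot)), ⟨?_, ?_, ?_⟩,
    (madelungFun ρ θ).1, dF ((ρ.1, θ), (v.rhoDot, v.thetaDot)),
    fun t => madelungFun (r t) (θ + t • v.thetaDot), fun t => rfl, ?_, ?_⟩
  · simp [hr0]
  · refine (hvel ρ.1 v.rhoDot).congr' ?_
    filter_upwards [nhdsWithin_le_nhds hr] with t ht
    simp [ht, hr0]
  · exact ⟨fun t => θ + t • v.thetaDot, fun t => rfl, hvel θ v.thetaDot⟩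
  · simp [hr0]
  · have hmem : ∀ᶠ t in 𝓝 (0 : ℝ), (ρ.1 + t • v.rhoDot, θ + t • v.thetaDot) ∈ U :=
      (hline.prodMk hline').continuousAt.eventually (hU.mem_nhds (by simpa using hq))
    refine (hdF _ hq (v.rhoDot, v.thetaDot)).congr' ?_
    filter_upwards [nhdsWithin_le_nhds hr, nhdsWithin_le_nhds hmem] with t ht htU
    have h1 : (madelungFun (r t) (θ + t • v.thetaDot)).1 =
        F (ρ.1 + t • v.rhoDot, θ + t • v.thetaDot) := by
      rw [hFU _ _ (by rwa [ht]), ht]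
    have h0 : (madelungFun (r 0) (θ + (0 : ℝ) • v.thetaDot)).1 = F (ρ.1, θ) := by
      rw [hr0, zero_smul, add_zero, hFU _ _ hq]
    rw [h1, h0]
    rfl

omit [CompactSpace M] [BorelSpace M] [IsManifold (𝓡 n) ∞ M] in
-- Logarithmic differentiation of `√ρ e^{iθ/2}`. The factored form makes a varying phase of the lift
-- appear as an additive constant.
theorem hasDerivAt_madelungFun {r : ℝ → Dens n μ} {θ : ℝ → SmoothFun n M ℝ} {x : M} {a b : ℝ}
    (hr : HasDerivAt (fun t => (r t).1 x) a 0) (hθ : HasDerivAt (fun t => θ t x) b 0) :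
    HasDerivAt (fun t => (madelungFun (r t) (θ t)).1 x)
      ((madelungFun (r 0) (θ 0)).1 x * (a / (2 * (r 0).1 x) + Complex.I * (b / 2))) 0 := by
  have hpos := (r 0).2.1 x
  have h1 := (hr.sqrt hpos.ne').ofReal_comp
  have h2 := ((hθ.ofReal_comp.div_const 2).const_mul Complex.I).cexp
  refine (h1.mul h2).congr_deriv ?_
  rw [madelungFun_apply]
  have h3 : (Real.sqrt ((r 0).1 x) : ℂ) ≠ 0 :=
    Complex.ofReal_ne_zero.2 (Real.sqrt_pos.2 hpos).ne'
  have h4 : (((r 0).1 x : ℝ) : ℂ) = (Real.sqrt ((r 0).1 x) : ℂ) ^ 2 := by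
    rw [← Complex.ofReal_pow, Real.sq_sqrt hpos.le]
  rw [h4]
  push_cast
  field_simp

omit [CompactSpace M] [BorelSpace M] in
/-- The velocity of a lift of the image of a curve under the Madelung transform. -/
theorem exists_velocity_eq [Nonempty M] {p : CotangentDens n μ} {v : p.Tangent}
    {γ : ℝ → CotangentDens n μ} (hγ : CotangentDens.HasVelocityAt γ p v) {ψ ψ' : SmoothFun n M ℂ}
    (hψ : ProjWave.HasVelocityAt (fun t => (madelung n μ (γ t) : ProjWave n μ)) ψ ψ') :
    (∀ x, ‖ψ x‖ ^ 2 = p.1.1 x) ∧ ∃ a : ℝ, ∀ x,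
      ψ' x = ψ x * (((v.rhoDot x / (2 * p.1.1 x) : ℝ) : ℂ) +
        Complex.I * ((v.thetaDot x / 2 + a : ℝ) : ℂ)) := by
  obtain ⟨hγ0, hr, θ, hθγ, hθ⟩ := hγ
  obtain ⟨Ψ, hΨγ, rfl, hΨ⟩ := hψ
  subst hγ0
  have hΨm (t : ℝ) : ∃ α : ℝ, ∀ x, (Ψ t).1 x =
      Complex.exp (Complex.I * α) * (madelungFun (γ t).1 (θ t)).1 x := by
    have h1 : (⟦madelungFun (γ t).1 (θ t)⟧ : ProjWave n μ) = ⟦Ψ t⟧ := by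
      rw [hΨγ t, ← madelung_mk, hθγ t]
    exact Quotient.exact h1
  choose α hα using hΨm
  set e : ℝ → ℂ := fun t => Complex.exp (Complex.I * α t) with he
  have hm (x : M) := hasDerivAt_madelungFun (r := fun t => (γ t).1) (hr.hasDerivAt_eval x)
    (hθ.hasDerivAt_eval x)
  -- The angles `α t` are arbitrary choices, possibly discontinuous in `t`. The phase factor `e` is
  -- still differentiable at 0, being a quotient of two differentiable functions at any one point of
  -- `M`.
  have he' : ∃ d : ℂ, HasDerivAt e d 0 := by
    obtain ⟨x⟩ := (inferInstance : Nonempty M)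
    refine ⟨_, ((hΨ.hasDerivAt_eval x).div (hm x) (madelungFun_ne_zero _ _ x)).congr_of_eventuallyEq
      (Eventually.of_forall fun t => ?_)⟩
    show e t = (Ψ t).1 x / (madelungFun (γ t).1 (θ t)).1 x
    rw [hα t x, mul_div_cancel_right₀ _ (madelungFun_ne_zero _ _ x)]
  obtain ⟨d, hd⟩ := he'
  have hnorm (t : ℝ) : ‖e t‖ = 1 := norm_exp_I_mul (α t)
  -- Since `|e| = 1`, the derivative of `e` is `e 0` times an imaginary number, whose imaginary part
  -- is the constant `a`.
  have hda : d = e 0 * (Complex.I * ((conj (e 0) * d).im : ℂ)) := by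
    have h1 := hd.norm_sq
    have h2 : HasDerivAt (fun t => ‖e t‖ ^ 2) 0 0 := by
      simp only [hnorm]
      exact hasDerivAt_const _ _
    have h3 := h1.unique h2
    rw [Complex.inner] at h3
    have h4 : (conj (e 0) * d).re = 0 := by
      rcases mul_eq_zero.1 h3 with h | h
      · norm_num at h
      · rwa [mul_comm] at h
    have h5 : Complex.I * ((conj (e 0) * d).im : ℂ) = conj (e 0) * d := by
      apply Complex.ext <;> simp [h4]
    rw [h5, ← mul_assoc, Complex.mul_conj, Complex.normSq_eq_norm_sq, hnorm]
    simp
  refine ⟨fun x => ?_, (conj (e 0) * d).im, fun x => ?_⟩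
  · rw [hα 0 x, norm_mul, norm_exp_I_mul, one_mul, norm_madelungFun,
      Real.sq_sqrt ((γ 0).1.2.1 x).le]
  · have h1 : HasDerivAt (fun t => (Ψ t).1 x) _ 0 :=
      (hd.mul (hm x)).congr_of_eventuallyEq (Eventually.of_forall fun t => hα t x)
    rw [(hΨ.hasDerivAt_eval x).unique h1, hα 0 x]
    show d * _ + e 0 * _ = e 0 * _ * _
    nth_rewrite 1 [hda]
    push_cast
    ring

omit [IsManifold (𝓡 n) ∞ M] in
-- Since `∫ u = 0`, `∫ w ρ = 0` and `∫ ρ = 1`, the product `⟨ψ, ψ'⟩` reduces to `i a`, and in `⟨ψ',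
-- ψ'⟩` the term linear in `a` drops out, leaving an excess of `a²`. The correction `⟨ψ, ψ'⟩⟨ψ', ψ⟩
-- = a²` cancels it.
theorem fubiniStudy_eq [IsFiniteMeasure μ] {ρ : Dens n μ} {ψ ψ' : SmoothFun n M ℂ}
    {u w : SmoothFun n M ℝ} {a : ℝ} (hu : ∫ x, u x ∂μ = 0) (hw : ∫ x, w x * ρ.1 x ∂μ = 0)
    (hρ : ∀ x, ‖ψ x‖ ^ 2 = ρ.1 x)
    (h : ∀ x, ψ' x = ψ x * (((u x / (2 * ρ.1 x) : ℝ) : ℂ) +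
        Complex.I * ((w x / 2 + a : ℝ) : ℂ))) :
    fubiniStudy μ ψ ψ' =
      ((1 / 4 * ∫ x, ((u x / ρ.1 x) ^ 2 + w x ^ 2) * ρ.1 x ∂μ : ℝ) : ℂ) := by
  have hcρ : Continuous fun x => ρ.1 x := ρ.1.contMDiff.continuous
  have hcu : Continuous fun x => u x := u.contMDiff.continuous
  have hcw : Continuous fun x => w x := w.contMDiff.continuous
  have hpos (x : M) : ρ.1 x ≠ 0 := (ρ.2.1 x).ne'
  have hsq (x : M) : conj (ψ x) * ψ x = (ρ.1 x : ℂ) := by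
    rw [mul_comm, Complex.mul_conj, Complex.normSq_eq_norm_sq, hρ]
  have h00 : hermitianL2 μ ψ ψ = 1 := by
    simp only [hermitianL2, hsq]
    rw [integral_complex_ofReal, ρ.2.2, Complex.ofReal_one]
  have i1 : Integrable (fun x => u x) μ := integrable_of_continuous hcu
  have i2 : Integrable (fun x => w x * ρ.1 x) μ := integrable_of_continuous (hcw.mul hcρ)
  have i3 : Integrable (fun x => ρ.1 x) μ := integrable_of_continuous hcρ
  have h01 : hermitianL2 μ ψ ψ' = Complex.I * a := by
    have h1 (x : M) : conj (ψ x) * ψ' x =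
        ((1 / 2 * u x : ℝ) : ℂ) + Complex.I * ((1 / 2 * (w x * ρ.1 x) + a * ρ.1 x : ℝ) : ℂ) := by
      have hx : (ρ.1 x : ℂ) ≠ 0 := Complex.ofReal_ne_zero.2 (hpos x)
      rw [h x, ← mul_assoc, hsq]
      push_cast
      field_simp
    simp only [hermitianL2, h1]
    rw [integral_add (i1.const_mul _).ofReal
      (((i2.const_mul _).add (i3.const_mul _)).ofReal.const_mul _), integral_const_mul,
      integral_complex_ofReal, integral_complex_ofReal, integral_add (i2.const_mul _) (i3.const_mul _),
      integral_const_mul, integral_const_mul, integral_const_mul, hu, hw, ρ.2.2]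
    simp
  have h10 : hermitianL2 μ ψ' ψ = -(Complex.I * a) := by
    have h1 : hermitianL2 μ ψ' ψ = conj (hermitianL2 μ ψ ψ') := by
      simp only [hermitianL2, ← integral_conj, map_mul, Complex.conj_conj, mul_comm]
    rw [h1, h01]
    simp
  have i4 : Integrable (fun x => ((u x / ρ.1 x) ^ 2 + w x ^ 2) * ρ.1 x) μ :=
    integrable_of_continuous ((((hcu.div hcρ hpos).pow 2).add (hcw.pow 2)).mul hcρ)
  have h11 : hermitianL2 μ ψ' ψ' =
      ((1 / 4 * ∫ x, ((u x / ρ.1 x) ^ 2 + w x ^ 2) * ρ.1 x ∂μ + a ^ 2 : ℝ) : ℂ) := by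
    have h1 (x : M) : conj (ψ' x) * ψ' x =
        ((1 / 4 * (((u x / ρ.1 x) ^ 2 + w x ^ 2) * ρ.1 x) + (a * (w x * ρ.1 x) +
          a ^ 2 * ρ.1 x) : ℝ) : ℂ) := by
      have hx : ρ.1 x ≠ 0 := hpos x
      rw [h x, mul_comm, Complex.mul_conj, map_mul, Complex.normSq_eq_norm_sq, hρ,
        mul_comm Complex.I, Complex.normSq_add_mul_I]
      congr 1
      field_simp
      ring
    have i5 : Integrable (fun x => a * (w x * ρ.1 x) + a ^ 2 * ρ.1 x) μ :=
      (i2.const_mul _).add (i3.const_mul _)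
    simp only [hermitianL2, h1]
    rw [integral_complex_ofReal, integral_add (i4.const_mul _) i5,
      integral_add (i2.const_mul _) (i3.const_mul _), integral_const_mul, integral_const_mul,
      integral_const_mul, hw, ρ.2.2]
    simp
  rw [fubiniStudy, h00, h01, h10, h11]
  push_cast
  linear_combination (a : ℂ) ^ 2 * Complex.I_sq

end Metric

end MadelungGeometry

end

/-! ### The isometry theorem -/

open MadelungGeometry
theorem mainTheorem2 {n : ℕ} {M : Type*} [TopologicalSpace M] [T2Space M] [CompactSpace M]
    [ConnectedSpace M] [ChartedSpace (EuclideanSpace ℝ (Fin n)) M] [IsManifold (𝓡 n) ∞ M]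
    [MeasurableSpace M] [BorelSpace M]
    (g : Bundle.ContMDiffRiemannianMetric (𝓡 n) ∞ (EuclideanSpace ℝ (Fin n))
      (fun x : M => TangentSpace (𝓡 n) x))
    (μ : Measure M) (hμ : μ = riemannianVolume g)
    (Φ : CotangentDens n μ → ProjWave n μ) (hΦ : ∀ p, Φ p = (madelung n μ p : ProjWave n μ)) :
    -- a homeomorphism onto an open subset of the projective space
    IsOpenEmbedding Φ ∧
    -- a diffeomorphism onto this subset
    SmoothToProj Φ ∧
    (∃ Ψ : Set.range Φ → CotangentDens n μ,
      (∀ p, Ψ ⟨Φ p, p, rfl⟩ = p) ∧ SmoothFromProj (Set.range Φ) Ψ) ∧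
    -- every tangent vector has an image, and all its images have the same length as the vector
    (∀ (p : CotangentDens n μ) (v : p.Tangent),
      (∃ γ : ℝ → CotangentDens n μ, CotangentDens.HasVelocityAt γ p v ∧
        ∃ ψ ψ' : SmoothFun n M ℂ, ProjWave.HasVelocityAt (Φ ∘ γ) ψ ψ') ∧
      ∀ γ : ℝ → CotangentDens n μ, CotangentDens.HasVelocityAt γ p v →
        ∀ ψ ψ' : SmoothFun n M ℂ, ProjWave.HasVelocityAt (Φ ∘ γ) ψ ψ' →
          fubiniStudy μ ψ ψ' = (sasakiFisherRao v : ℂ)) ∧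
    -- the image consists of the classes of the functions that have a continuous logarithm
    (∀ ψ : WaveSphere n μ, (⟦ψ⟧ : ProjWave n μ) ∈ Set.range Φ ↔
      ∃ f : M → ℂ, Continuous f ∧ ∀ x, ψ.1 x = Complex.exp (f x)) ∧
    -- the image is everything if `M` is simply connected
    (SimplyConnectedSpace M → Function.Bijective (madelung n μ)) := by
  obtain rfl : Φ = fun p => (madelung n μ p : ProjWave n μ) := funext hΦ
  have : IsFiniteMeasure μ := hμ ▸ isFiniteMeasure_riemannianVolume g
  refine ⟨isOpenEmbedding_madelung, smoothToProj_madelung, exists_smoothFromProj_madelung,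
    fun p v => ⟨exists_curve_hasVelocityAt p v, fun γ hγ ψ ψ' hψ => ?_⟩,
    mk_mem_range_madelung_iff, fun _ => ⟨madelung_injective, madelung_surjective⟩⟩
  obtain ⟨hρ, a, h⟩ := exists_velocity_eq hγ hψ
  exact fubiniStudy_eq v.integral_rhoDot v.integral_thetaDot hρ h
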